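/- Let $k\ge 1$ be a fixed integer and $\beta\ge 0$ a fixed real number. For real order-$k$ tensors $\mathbf X,\mathbf Y\in\bigotimes^k\mathbb R^n$ put $\langle \mathbf X,\mathbf Y\rangle=\sum_{i_1,\dots,i_k}\mathbf X_{i_1\dots i_k}\mathbf Y_{i_1\dots i_k}$ and $$\|\mathbf X\|_{op}=\max\{\langle \mathbf X,\mathbf u_1\otimes\cdots\otimes \mathbf u_k\rangle:\ \mathbf u_j\in\mathbb R^n,\ \|\mathbf u_j\|_2\le 1\ \text{for all } j\}.$$ For every $n\ge 1$ let $\mathbf v_0=\mathbf v_0(n)\in\mathbb R^n$ be a deterministic vector with $\|\mathbf v_0\|_2=1$, let $\mathbf G\in\bigotimes^k\mathbb R^n$ be a random tensor whose $n^k$ entries are i.i.d. ${\sf N}(0,1)$, and let $$\mathbf X=\mathbf X_n=\beta\,\mathbf v_0^{\otimes k}+\mathbf Z,\qquad \mathbf Z=\frac1{k!}\sqrt{\frac kn}\sum_{\pi\in\mathfrak S_k}\mathbf G^{\pi},\qquad \mathbf G^\pi_{i_1\dots i_k}=\mathbf G_{i_{\pi(1)}\dots i_{\pi(k)}}$$ (the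 spiked tensor model). Then $\mathbb E\|\mathbf X_n\|_{op}<\infty$ for every $n\ge 1$, the maximum below is attained, and $$\limsup_{n\to\infty}\mathbb E\|\mathbf X_n\|_{op}\ \le\ \max_{\tau\ge 0}\left\{\beta\left(\frac{\tau}{\sqrt{1+\tau^2}}\right)^k+\frac{k}{\sqrt{1+\tau^2}}\right\}.$$ Moreover, for every $n\ge 1$ and every $s\ge 0$, $$\mathbb P\left(\big|\|\mathbf X_n\|_{op}-\mathbb E\|\mathbf X_n\|_{op}\big|\ge s\right)\le 2\,e^{-ns^2/(2k)}.$$ -/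

import Mathlib

open MeasureTheory ProbabilityTheory

namespace SpikedTensor

/-- Real tensors of order `k` over `ℝⁿ`, given by their coordinates. -/
abbrev Tensor (k n : ℕ) : Type := (Fin k → Fin n) → ℝ

/-- The inner product `⟨X, Y⟩ = ∑_{i₁,…,iₖ} X_{i₁…iₖ} Y_{i₁…iₖ}`. -/
def tinner {k n : ℕ} (X Y : Tensor k n) : ℝ := ∑ i, X i * Y i

/-- The outer product `u₁ ⊗ ⋯ ⊗ uₖ`. -/
def outer {k n : ℕ} (u : Fin k → EuclideanSpace ℝ (Fin n)) : Tensor k n :=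
  fun i => ∏ j, u j (i j)

/-- The outer power `v^{⊗k}`. -/
def outerPow (k : ℕ) {n : ℕ} (v : EuclideanSpace ℝ (Fin n)) : Tensor k n :=
  outer fun _ => v

/-- The tensor `X^π` with permuted indices. -/
def permute {k n : ℕ} (π : Equiv.Perm (Fin k)) (X : Tensor k n) : Tensor k n :=
  fun i => X (i ∘ π)

/-- The values `⟨X, u₁ ⊗ ⋯ ⊗ uₖ⟩` over all `u₁, …, uₖ` in the closed unit ball. -/
def opValues {k n : ℕ} (X : Tensor k n) : Set ℝ :=
  {r | ∃ u : Fin k → EuclideanSpace ℝ (Fin n), (∀ j, ‖u j‖ ≤ 1) ∧ r = tinner X (outer u)}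

/-- The operator (injective) norm of a tensor; the supremum is a maximum by
`isGreatest_opNorm`. -/
noncomputable def opNorm {k n : ℕ} (X : Tensor k n) : ℝ := sSup (opValues X)

theorem isGreatest_opNorm {k n : ℕ} (X : Tensor k n) : IsGreatest (opValues X) (opNorm X) := by
  have hc : IsCompact (opValues X) := by
    have h1 : IsCompact (Set.univ.pi fun _ : Fin k =>
        Metric.closedBall (0 : EuclideanSpace ℝ (Fin n)) 1) :=
      isCompact_univ_pi fun _ => isCompact_closedBall _ _
    have h2 : Continuous fun u : Fin k → EuclideanSpace ℝ (Fin n) => tinner X (outer u) := by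
      unfold tinner outer
      fun_prop
    have h3 := h1.image h2
    convert h3 using 1
    ext r
    simp only [opValues, Set.mem_ofPred_eq, Set.mem_image, Set.mem_pi, Set.mem_univ, true_imp_iff,
      mem_closedBall_zero_iff]
    exact ⟨fun ⟨u, hu, hr⟩ => ⟨u, hu, hr.symm⟩, fun ⟨u, hu, hr⟩ => ⟨u, hu, hr.symm⟩⟩
  have hne : (opValues X).Nonempty := ⟨_, fun _ => 0, fun _ => by simp, rfl⟩
  exact hc.isGreatest_sSup hne

/-- `G` is a random tensor with i.i.d. standard normal coordinates (no symmetry is imposed). -/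
def IsStdGaussianTensor {k n : ℕ} {Ω : Type*} [MeasurableSpace Ω] (G : Ω → Tensor k n)
    (P : Measure Ω) : Prop :=
  (∀ i, HasLaw (fun ω => G ω i) (gaussianReal 0 1) P) ∧ iIndepFun (fun i ω => G ω i) P

/-- The symmetric noise tensor `Z = (1/k!) √(k/n) ∑_π G^π` built from `G`. -/
noncomputable def symNoise {k n : ℕ} (G : Tensor k n) : Tensor k n :=
  (1 / (k.factorial : ℝ) * √((k : ℝ) / n)) • ∑ π : Equiv.Perm (Fin k), permute π G

/-- The spiked tensor `X = β v₀^{⊗k} + Z`, where `Z` is built from `G`. -/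
noncomputable def spiked {k n : ℕ} (β : ℝ) (v₀ : EuclideanSpace ℝ (Fin n)) (G : Tensor k n) :
    Tensor k n :=
  β • outerPow k v₀ + symNoise G

end SpikedTensor

namespace SpikedTensor

/-! The tensor `X` is symmetric, so by Banach's theorem (`exists_abs_multilinear_le_diagonal`) its
operator norm is the supremum, over signs `ε` and unit vectors `v`, of `ε (β ⟨v₀, v⟩ ^ k + √(k/n)
⟨v^{⊗k}, G⟩)`. This is a supremum of affine functions of a standard Gaussian vector, and the noise
parts have covariance `(k/n) ε ε' ⟨v, w⟩ ^ k`, bounded by `k/n`.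

For the mean, the noise is replaced by `(k/√n) ⟨v, g⟩ + ε √(k/n) ξ`, with `g` a standard Gaussian
vector and `ξ` an independent scalar Gaussian. Bernoulli's inequality `1 - ρ ^ k ≤ k (1 - ρ)` shows
that this enlarges all increments, so Sudakov–Fernique (`integral_sup_affine_le`) bounds the mean
from above. With `t = ⟨v₀, v⟩`, the new supremum is at most `max (β |t| ^ k + k √(1 - t²))` plus
terms whose mean is `O(1/√n)`; the substitution `t = τ / √(1 + τ²)` gives the stated maximum.

The comparison and the concentration come from one interpolation. Two Gaussian families `a`, `b` are
rotated into each other, and `E[F(rotated) exp (t F(a))]` is differentiated in the angle, where `F`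
is `logSumExp` (`hasDerivAt_integral_logSumExp_rotate`). Gaussian integration by parts expresses the
derivative through covariances. For `t = 0` it is nonnegative when `b` has the larger increments. If
`b` is an independent copy of `a`, integrating it bounds the covariance of `F` and `exp (t F)`; this
is a differential inequality for the log moment generating function and yields the sharp
sub-Gaussian constant. Letting the inverse temperature and the size of a finite subfamily of a dense
sequence grow together carries both results over to suprema. -/

/-- The standard Gaussian measure on `ℝ^κ`. -/
noncomputable abbrev stdGauss (κ : Type*) [Fintype κ] : Measure (κ → ℝ) :=
  Measure.pi fun _ => gaussianReal 0 1

/-! ### Exponential growth, integrability and Gaussian integration by parts. -/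

section Growth

variable {κ : Type*} [Fintype κ]

/-- Functions on `ℝ^κ` of at most exponential growth. -/
def ExpGrowth (f : (κ → ℝ) → ℝ) : Prop :=
  ∃ C K : ℝ, 0 ≤ C ∧ 0 ≤ K ∧ ∀ g, |f g| ≤ C * Real.exp (K * ∑ l, |g l|)

namespace ExpGrowth

theorem mono {f h : (κ → ℝ) → ℝ} (hf : ExpGrowth f) (hfh : ∀ g, |h g| ≤ |f g|) :
    ExpGrowth h := by
  obtain ⟨C, K, hC, hK, h1⟩ := hf
  exact ⟨C, K, hC, hK, fun g => (hfh g).trans (h1 g)⟩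

theorem const (c : ℝ) : ExpGrowth fun _ : κ → ℝ => c :=
  ⟨|c|, 0, abs_nonneg _, le_rfl, fun g => by simp⟩

theorem of_bounded {f : (κ → ℝ) → ℝ} (c : ℝ) (hf : ∀ g, |f g| ≤ c) : ExpGrowth f :=
  (const c).mono fun g => (hf g).trans (le_abs_self c)

theorem add {f h : (κ → ℝ) → ℝ} (hf : ExpGrowth f) (hh : ExpGrowth h) :
    ExpGrowth fun g => f g + h g := by
  obtain ⟨C, K, hC, hK, h1⟩ := hf
  obtain ⟨C', K', hC', hK', h2⟩ := hh
  refine ⟨C + C', K + K', by positivity, by positivity, fun g => ?_⟩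
  have hs : 0 ≤ ∑ l, |g l| := Finset.sum_nonneg fun _ _ => abs_nonneg _
  calc |f g + h g| ≤ |f g| + |h g| := abs_add_le _ _
    _ ≤ C * Real.exp (K * ∑ l, |g l|) + C' * Real.exp (K' * ∑ l, |g l|) :=
        add_le_add (h1 g) (h2 g)
    _ ≤ C * Real.exp ((K + K') * ∑ l, |g l|) + C' * Real.exp ((K + K') * ∑ l, |g l|) := by
        gcongr <;> linarith
    _ = _ := by ring

theorem mul {f h : (κ → ℝ) → ℝ} (hf : ExpGrowth f) (hh : ExpGrowth h) :
    ExpGrowth fun g => f g * h g := by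
  obtain ⟨C, K, hC, hK, h1⟩ := hf
  obtain ⟨C', K', hC', hK', h2⟩ := hh
  refine ⟨C * C', K + K', by positivity, by positivity, fun g => ?_⟩
  calc |f g * h g| = |f g| * |h g| := abs_mul _ _
    _ ≤ (C * Real.exp (K * ∑ l, |g l|)) * (C' * Real.exp (K' * ∑ l, |g l|)) := by
        gcongr
        exacts [h1 g, h2 g]
    _ = _ := by rw [add_mul, Real.exp_add]; ring

theorem sum {ι : Type*} (s : Finset ι) {f : ι → (κ → ℝ) → ℝ} (hf : ∀ i ∈ s, ExpGrowth (f i)) :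
    ExpGrowth fun g => ∑ i ∈ s, f i g := by
  classical
  induction s using Finset.induction_on with
  | empty => simpa using const 0
  | insert i s hi ih =>
    simp only [Finset.sum_insert hi]
    exact (hf i (by simp)).add (ih fun j hj => hf j (by simp [hj]))

theorem l1 : ExpGrowth fun g : κ → ℝ => ∑ l, |g l| := by
  refine ⟨1, 1, zero_le_one, zero_le_one, fun g => ?_⟩
  rw [abs_of_nonneg (Finset.sum_nonneg fun _ _ => abs_nonneg _)]
  linarith [Real.add_one_le_exp (1 * ∑ l, |g l|)]

theorem eval (l : κ) : ExpGrowth fun g : κ → ℝ => g l :=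
  l1.mono fun g => (Finset.single_le_sum (f := fun l => |g l|) (fun _ _ => abs_nonneg _)
    (Finset.mem_univ l)).trans (le_abs_self _)

theorem exp_of_le {f : (κ → ℝ) → ℝ} (C K : ℝ) (hK : 0 ≤ K)
    (hf : ∀ g, f g ≤ C + K * ∑ l, |g l|) : ExpGrowth fun g => Real.exp (f g) :=
  ⟨Real.exp C, K, (Real.exp_pos _).le, hK, fun g => by
    rw [abs_of_pos (Real.exp_pos _), ← Real.exp_add]
    exact Real.exp_le_exp.2 (hf g)⟩

theorem integrable_exp_l1 (K : ℝ) :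
    Integrable (fun g : κ → ℝ => Real.exp (K * ∑ l, |g l|)) (stdGauss κ) := by
  have h : ∀ _ : κ, Integrable (fun x : ℝ => Real.exp (K * |x|)) (gaussianReal 0 1) := fun _ =>
    integrable_exp_mul_abs (integrable_exp_mul_gaussianReal K) (integrable_exp_mul_gaussianReal _)
  have := Integrable.fintype_prod (μ := fun _ : κ => gaussianReal 0 1) h
  simpa only [Finset.mul_sum, Real.exp_sum] using this

theorem integrable {f : (κ → ℝ) → ℝ} (hf : ExpGrowth f)
    (hm : AEStronglyMeasurable f (stdGauss κ)) : Integrable f (stdGauss κ) := by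
  obtain ⟨C, K, hC, hK, h1⟩ := hf
  exact ((integrable_exp_l1 K).const_mul C).mono' hm (Filter.Eventually.of_forall h1)

theorem integrable_of_continuous {f : (κ → ℝ) → ℝ} (hf : ExpGrowth f) (hc : Continuous f) :
    Integrable f (stdGauss κ) :=
  hf.integrable hc.aestronglyMeasurable

end ExpGrowth

theorem integrable_gaussianReal_iff {f : ℝ → ℝ} :
    Integrable f (gaussianReal 0 1) ↔ Integrable fun x => gaussianPDFReal 0 1 x * f x := by
  rw [gaussianReal_of_var_ne_zero _ one_ne_zero,
    integrable_withDensity_iff_integrable_smul' (measurable_gaussianPDF 0 1)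
      (Filter.Eventually.of_forall fun x => gaussianPDF_lt_top)]
  simp [toReal_gaussianPDF]

theorem hasDerivAt_gaussianPDFReal (x : ℝ) :
    HasDerivAt (gaussianPDFReal 0 1) (-(x * gaussianPDFReal 0 1 x)) x := by
  have h : HasDerivAt (fun x : ℝ => (√(2 * Real.pi * (1 : NNReal)))⁻¹ *
      Real.exp (-(x - 0) ^ 2 / (2 * (1 : NNReal)))) _ x :=
    ((((((hasDerivAt_id x).sub_const 0).pow 2).neg).div_const _).exp).const_mul _
  have e : gaussianPDFReal 0 1 = fun x : ℝ => (√(2 * Real.pi * (1 : NNReal)))⁻¹ *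
      Real.exp (-(x - 0) ^ 2 / (2 * (1 : NNReal))) := by
    ext x; rw [gaussianPDFReal]
  rw [e]
  convert h using 1
  simp
  ring

/-- The standard Gaussian density `φ` satisfies `φ' = -x φ`, so this is integration by parts on the
line without boundary terms. -/
theorem integral_mul_gaussianReal {u u' : ℝ → ℝ} (hu : ∀ x, HasDerivAt u (u' x) x)
    (hi : Integrable u (gaussianReal 0 1)) (hi' : Integrable u' (gaussianReal 0 1))
    (hxi : Integrable (fun x => x * u x) (gaussianReal 0 1)) :
    ∫ x, x * u x ∂(gaussianReal 0 1) = ∫ x, u' x ∂(gaussianReal 0 1) := by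
  rw [integrable_gaussianReal_iff] at hi hi' hxi
  have := integral_mul_deriv_eq_deriv_mul_of_integrable (u := u) (v := gaussianPDFReal 0 1)
    (u' := u') (v' := fun x => -(x * gaussianPDFReal 0 1 x))
    (fun x _ => hu x) (fun x _ => hasDerivAt_gaussianPDFReal x)
    (hxi.neg.congr (Filter.Eventually.of_forall fun x => by simp; ring))
    (hi'.congr (Filter.Eventually.of_forall fun x => by simp; ring))
    (hi.congr (Filter.Eventually.of_forall fun x => by simp; ring))
  rw [integral_gaussianReal_eq_integral_smul one_ne_zero,
    integral_gaussianReal_eq_integral_smul one_ne_zero]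
  calc ∫ x, gaussianPDFReal 0 1 x • (x * u x)
      = -∫ x, u x * -(x * gaussianPDFReal 0 1 x) := by
        rw [← integral_neg]; congr 1; ext x; simp; ring
    _ = _ := by rw [this, neg_neg]; congr 1; ext x; simp; ring

/-- Resampling one coordinate independently preserves the law. This isolates a coordinate for Fubini
without splitting the index type. -/
theorem measurePreserving_update [DecidableEq κ] (l : κ) :
    MeasurePreserving (fun p : (κ → ℝ) × ℝ => Function.update p.1 l p.2)
      ((stdGauss κ).prod (gaussianReal 0 1)) (stdGauss κ) := by
  have hm : Measurable fun p : (κ → ℝ) × ℝ => Function.update p.1 l p.2 := by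
    refine measurable_pi_iff.2 fun j => ?_
    by_cases h : j = l
    · subst h; simpa using measurable_snd
    · simp only [Function.update_of_ne h]
      fun_prop
  refine ⟨hm, (Measure.pi_eq fun s hs => ?_).symm⟩
  rw [Measure.map_apply hm (MeasurableSet.univ_pi hs)]
  have e : (fun p : (κ → ℝ) × ℝ => Function.update p.1 l p.2) ⁻¹' (Set.univ.pi s) =
      (Set.univ.pi (Function.update s l Set.univ)) ×ˢ s l := by
    ext p
    simp only [Set.mem_preimage, Set.mem_pi, Set.mem_univ, true_imp_iff, Set.mem_prod]
    constructor
    · intro h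
      refine ⟨fun j => ?_, by simpa using h l⟩
      by_cases hj : j = l
      · subst hj; simp
      · simpa [Function.update_of_ne hj] using h j
    · rintro ⟨h1, h2⟩ j
      by_cases hj : j = l
      · subst hj; simpa using h2
      · simpa [Function.update_of_ne hj] using h1 j
  rw [e, Measure.prod_prod, Measure.pi_pi, ← Finset.mul_prod_erase _ _ (Finset.mem_univ l),
    ← Finset.mul_prod_erase Finset.univ (fun i => gaussianReal 0 1 (s i)) (Finset.mem_univ l),
    mul_comm (gaussianReal 0 1 (s l))]
  simp only [Function.update_self, measure_univ, one_mul]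
  congr 1
  refine Finset.prod_congr rfl fun j hj => ?_
  rw [Function.update_of_ne (Finset.ne_of_mem_erase hj)]

/-- Gaussian integration by parts in one coordinate. -/
theorem integral_eval_mul_stdGauss [DecidableEq κ] (l : κ) {f f' : (κ → ℝ) → ℝ}
    (hfc : Continuous f) (hfc' : Continuous f') (hf : ExpGrowth f) (hf' : ExpGrowth f')
    (hd : ∀ g, HasDerivAt (fun t => f (Function.update g l t)) (f' g) (g l)) :
    ∫ g, g l * f g ∂(stdGauss κ) = ∫ g, f' g ∂(stdGauss κ) := by
  -- Resample coordinate `l`, condition on the other coordinates, and apply the one-dimensional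
  -- formula to almost every slice.
  have mp := measurePreserving_update l
  have key : ∀ F : (κ → ℝ) → ℝ, Integrable F (stdGauss κ) →
      ∫ g, F g ∂(stdGauss κ) =
        ∫ g, ∫ t, F (Function.update g l t) ∂(gaussianReal 0 1) ∂(stdGauss κ) := by
    intro F hF
    have h1 := mp.integrable_comp_of_integrable hF
    have h2 := integral_map mp.measurable.aemeasurable (f := F) (by rw [mp.map_eq]; exact hF.1)
    rw [mp.map_eq] at h2
    exact h2.trans (integral_prod _ h1)
  have key2 : ∀ F : (κ → ℝ) → ℝ, Integrable F (stdGauss κ) →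
      ∀ᵐ g ∂(stdGauss κ), Integrable (fun t => F (Function.update g l t)) (gaussianReal 0 1) :=
    fun F hF => (mp.integrable_comp_of_integrable hF).prod_right_ae
  have i1 := hf.integrable_of_continuous hfc
  have i2 := hf'.integrable_of_continuous hfc'
  have i3 := ((ExpGrowth.eval l).mul hf).integrable_of_continuous ((continuous_apply l).mul hfc)
  rw [key _ i3, key _ i2]
  refine integral_congr_ae ?_
  filter_upwards [key2 _ i1, key2 _ i2, key2 _ i3] with g h1 h2 h3
  simp only [Function.update_self] at h3 ⊢
  refine integral_mul_gaussianReal (fun t => ?_) h1 h2 h3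
  simpa using hd (Function.update g l t)

end Growth

/-! ### The smooth maximum and its Gibbs weights. -/

section Softmax

variable {ι : Type*} [Fintype ι]

/-- The function `log ∑ exp (s i)`. -/
noncomputable def logSumExp (s : ι → ℝ) : ℝ := Real.log (∑ i, Real.exp (s i))

/-- The Gibbs weights `exp (s i) / ∑ exp (s j)`. -/
noncomputable def softmax (s : ι → ℝ) (i : ι) : ℝ := Real.exp (s i) / ∑ j, Real.exp (s j)

theorem softmax_nonneg (s : ι → ℝ) (i : ι) : 0 ≤ softmax s i :=
  div_nonneg (Real.exp_pos _).le (Finset.sum_nonneg fun _ _ => (Real.exp_pos _).le)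

variable [Nonempty ι]

theorem sum_exp_pos (s : ι → ℝ) : 0 < ∑ i, Real.exp (s i) :=
  Finset.sum_pos (fun _ _ => Real.exp_pos _) Finset.univ_nonempty

theorem sum_softmax (s : ι → ℝ) : ∑ i, softmax s i = 1 := by
  simp only [softmax, ← Finset.sum_div]
  exact div_self (sum_exp_pos s).ne'

theorem softmax_le_one (s : ι → ℝ) (i : ι) : softmax s i ≤ 1 := by
  rw [← sum_softmax s]
  exact Finset.single_le_sum (fun j _ => softmax_nonneg s j) (Finset.mem_univ i)

theorem abs_softmax_le_one (s : ι → ℝ) (i : ι) : |softmax s i| ≤ 1 := by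
  rw [abs_of_nonneg (softmax_nonneg s i)]; exact softmax_le_one s i

theorem le_logSumExp (s : ι → ℝ) (i : ι) : s i ≤ logSumExp s := by
  rw [logSumExp, Real.le_log_iff_exp_le (sum_exp_pos s)]
  exact Finset.single_le_sum (f := fun i => Real.exp (s i)) (fun _ _ => (Real.exp_pos _).le)
    (Finset.mem_univ i)

theorem logSumExp_le {s : ι → ℝ} {c : ℝ} (h : ∀ i, s i ≤ c) :
    logSumExp s ≤ Real.log (Fintype.card ι) + c := by
  have hc : (0 : ℝ) < Fintype.card ι := by exact_mod_cast Fintype.card_pos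
  rw [logSumExp, Real.log_le_iff_le_exp (sum_exp_pos s), Real.exp_add, Real.exp_log hc]
  calc ∑ i, Real.exp (s i) ≤ ∑ _i : ι, Real.exp c :=
        Finset.sum_le_sum fun i _ => Real.exp_le_exp.2 (h i)
    _ = _ := by simp

theorem abs_logSumExp_le (s : ι → ℝ) :
    |logSumExp s| ≤ Real.log (Fintype.card ι) + ∑ i, |s i| := by
  have h0 : ∀ i, |s i| ≤ ∑ i, |s i| := fun i =>
    Finset.single_le_sum (f := fun i => |s i|) (fun _ _ => abs_nonneg _) (Finset.mem_univ i)
  have hl : 0 ≤ Real.log (Fintype.card ι) := Real.log_natCast_nonneg _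
  obtain ⟨i⟩ := ‹Nonempty ι›
  refine abs_le.2 ⟨?_, logSumExp_le fun i => (le_abs_self _).trans (h0 i)⟩
  have := le_logSumExp s i
  have := neg_abs_le (s i)
  have := h0 i
  linarith

theorem continuous_logSumExp : Continuous (logSumExp : (ι → ℝ) → ℝ) := by
  unfold logSumExp
  exact Continuous.log (by fun_prop) fun s => (sum_exp_pos s).ne'

theorem continuous_softmax (i : ι) : Continuous fun s : ι → ℝ => softmax s i := by
  unfold softmax
  exact Continuous.div (by fun_prop) (by fun_prop) fun s => (sum_exp_pos s).ne'

theorem hasDerivAt_logSumExp {s : ℝ → ι → ℝ} {s' : ι → ℝ} {x : ℝ}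
    (h : ∀ i, HasDerivAt (fun x => s x i) (s' i) x) :
    HasDerivAt (fun x => logSumExp (s x)) (∑ i, softmax (s x) i * s' i) x := by
  have h1 : HasDerivAt (fun x => ∑ i, Real.exp (s x i)) (∑ i, Real.exp (s x i) * s' i) x :=
    HasDerivAt.fun_sum fun i _ => (h i).exp
  refine (h1.log (sum_exp_pos (s x)).ne').congr_deriv ?_
  rw [Finset.sum_div]
  exact Finset.sum_congr rfl fun i _ => by rw [softmax]; ring

/-- A Gibbs weight is `exp (s i - logSumExp s)`, and the derivative of `logSumExp` is the Gibbs
average of `s'`. -/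
theorem hasDerivAt_softmax {s : ℝ → ι → ℝ} {s' : ι → ℝ} {x : ℝ}
    (h : ∀ i, HasDerivAt (fun x => s x i) (s' i) x) (i : ι) :
    HasDerivAt (fun x => softmax (s x) i)
      (softmax (s x) i * (s' i - ∑ j, softmax (s x) j * s' j)) x := by
  have h1 : (fun x => softmax (s x) i) = fun x => Real.exp (s x i - logSumExp (s x)) := by
    ext y
    rw [Real.exp_sub, logSumExp, Real.exp_log (sum_exp_pos (s y)), softmax]
  have h2 := ((h i).sub (hasDerivAt_logSumExp h)).exp
  have h3 : softmax (s x) i = Real.exp (s x i - logSumExp (s x)) := congrFun h1 x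
  rw [h1, h3]
  exact h2

end Softmax

/-! ### Affine Gaussian families and their rotations. -/

section Affine

variable {ι κ : Type*}

/-- The rotation `cos θ • a + sin θ • b`. -/
noncomputable def rotate (a b : ι → κ → ℝ) (θ : ℝ) (i : ι) (l : κ) : ℝ :=
  Real.cos θ * a i l + Real.sin θ * b i l

theorem abs_rotate_le (a b : ι → κ → ℝ) (θ : ℝ) (i : ι) (l : κ) :
    |rotate a b θ i l| ≤ |a i l| + |b i l| := by
  refine (abs_add_le _ _).trans (add_le_add ?_ ?_) <;> rw [abs_mul]
  · exact mul_le_of_le_one_left (abs_nonneg _) (Real.abs_cos_le_one θ)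
  · exact mul_le_of_le_one_left (abs_nonneg _) (Real.abs_sin_le_one θ)

variable [Fintype κ]

/-- The affine functions `g ↦ m i + ⟨c i, g⟩`. -/
def affine (m : ι → ℝ) (c : ι → κ → ℝ) (g : κ → ℝ) (i : ι) : ℝ := m i + c i ⬝ᵥ g

theorem continuous_affine (m : ι → ℝ) (c : ι → κ → ℝ) : Continuous (affine m c) := by
  unfold affine dotProduct
  fun_prop

theorem abs_affine_le (m : ι → ℝ) (c : ι → κ → ℝ) (g : κ → ℝ) (i : ι) :
    |affine m c g i| ≤ |m i| + (∑ l, |c i l|) * ∑ l, |g l| := by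
  refine (abs_add_le _ _).trans (add_le_add le_rfl ?_)
  rw [dotProduct, Finset.sum_mul]
  refine (Finset.abs_sum_le_sum_abs _ _).trans (Finset.sum_le_sum fun l _ => ?_)
  rw [abs_mul]
  gcongr
  exact Finset.single_le_sum (f := fun l => |g l|) (fun _ _ => abs_nonneg _) (Finset.mem_univ l)

theorem ExpGrowth.dotProduct (d : κ → ℝ) : ExpGrowth fun g => d ⬝ᵥ g :=
  ExpGrowth.sum _ fun l _ => (ExpGrowth.const (d l)).mul (ExpGrowth.eval l)

theorem hasDerivAt_affine_update [DecidableEq κ] (m : ι → ℝ) (c : ι → κ → ℝ) (g : κ → ℝ) (l : κ)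
    (i : ι) : HasDerivAt (fun t => affine m c (Function.update g l t) i) (c i l) (g l) := by
  unfold affine dotProduct
  have h : ∀ j ∈ Finset.univ, HasDerivAt (fun t => c i j * Function.update g l t j)
      (if j = l then c i l else 0) (g l) := by
    intro j _
    by_cases hj : j = l
    · subst hj
      simpa using (hasDerivAt_id (g j)).const_mul (c i j)
    · simpa [Function.update_of_ne hj, hj] using hasDerivAt_const (g l) (c i j * g j)
  simpa using (HasDerivAt.fun_sum h).const_add (m i)

theorem hasDerivAt_affine_rotate (m : ι → ℝ) (a b : ι → κ → ℝ) (g : κ → ℝ) (i : ι) (θ : ℝ) :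
    HasDerivAt (fun θ => affine m (rotate a b θ) g i) (rotate b (-a) θ i ⬝ᵥ g) θ := by
  unfold affine dotProduct rotate
  refine HasDerivAt.const_add _ (HasDerivAt.fun_sum fun l _ => HasDerivAt.mul_const ?_ _)
  refine (((Real.hasDerivAt_cos θ).mul_const (a i l)).add
    ((Real.hasDerivAt_sin θ).mul_const (b i l))).congr_deriv ?_
  simp only [Pi.neg_apply]
  ring

end Affine

/-! ### Differentiation along the rotation. -/

section Interpolation

variable {ι κ : Type*} [Fintype ι] [Nonempty ι] [Fintype κ]

theorem abs_logSumExp_affine_le (m : ι → ℝ) (c : ι → κ → ℝ) (g : κ → ℝ) :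
    |logSumExp (affine m c g)| ≤ (Real.log (Fintype.card ι) + ∑ i, |m i|) +
      (∑ i, ∑ l, |c i l|) * ∑ l, |g l| := by
  refine (abs_logSumExp_le _).trans ?_
  rw [add_assoc, Finset.sum_mul, ← Finset.sum_add_distrib]
  gcongr
  exact abs_affine_le m c g _

theorem ExpGrowth.logSumExp (m : ι → ℝ) (c : ι → κ → ℝ) :
    ExpGrowth fun g => logSumExp (affine m c g) := by
  refine ((ExpGrowth.const (Real.log (Fintype.card ι) + ∑ i, |m i|)).add
    ((ExpGrowth.const (∑ i, ∑ l, |c i l|)).mul ExpGrowth.l1)).mono fun g => ?_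
  exact (abs_logSumExp_affine_le m c g).trans (le_abs_self _)

theorem ExpGrowth.exp_logSumExp (m : ι → ℝ) (c : ι → κ → ℝ) (t : ℝ) :
    ExpGrowth fun g => Real.exp (t * SpikedTensor.logSumExp (affine m c g)) := by
  refine ExpGrowth.exp_of_le (|t| * (Real.log (Fintype.card ι) + ∑ i, |m i|))
    (|t| * (∑ i, ∑ l, |c i l|)) (by positivity) fun g => ?_
  calc _ ≤ |t| * |SpikedTensor.logSumExp (affine m c g)| := by
        rw [← abs_mul]; exact le_abs_self _
    _ ≤ |t| * ((Real.log (Fintype.card ι) + ∑ i, |m i|) +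
          (∑ i, ∑ l, |c i l|) * ∑ l, |g l|) := by
        gcongr; exact abs_logSumExp_affine_le m c g
    _ = _ := by ring

theorem continuous_logSumExp_affine (m : ι → ℝ) (c : ι → κ → ℝ) :
    Continuous fun g => logSumExp (affine m c g) :=
  continuous_logSumExp.comp (continuous_affine m c)

theorem continuous_softmax_affine (m : ι → ℝ) (c : ι → κ → ℝ) (i : ι) :
    Continuous fun g => softmax (affine m c g) i :=
  (continuous_softmax i).comp (continuous_affine m c)

theorem ExpGrowth.softmax (m : ι → ℝ) (c : ι → κ → ℝ) (i : ι) :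
    ExpGrowth fun g => softmax (affine m c g) i :=
  ExpGrowth.of_bounded 1 fun _ => abs_softmax_le_one _ _

/-- Integration by parts in the direction `d`: the first bracket comes from differentiating the
Gibbs weight, the term with the factor `t` from differentiating the exponential. -/
theorem integral_dotProduct_mul_softmax (m : ι → ℝ) (c a : ι → κ → ℝ) (t : ℝ) (d : κ → ℝ)
    (i : ι) :
    ∫ g, (d ⬝ᵥ g) * (softmax (affine m c g) i * Real.exp (t * logSumExp (affine m a g)))
        ∂(stdGauss κ) =
      ∫ g, (softmax (affine m c g) i *
          (c i ⬝ᵥ d - ∑ j, softmax (affine m c g) j * (c j ⬝ᵥ d)) +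
        t * softmax (affine m c g) i * ∑ j, softmax (affine m a g) j * (a j ⬝ᵥ d)) *
          Real.exp (t * logSumExp (affine m a g)) ∂(stdGauss κ) := by
  classical
  set f : (κ → ℝ) → ℝ := fun g =>
    softmax (affine m c g) i * Real.exp (t * logSumExp (affine m a g)) with hfdef
  set f' : κ → (κ → ℝ) → ℝ := fun l g => (softmax (affine m c g) i *
          (c i l - ∑ j, softmax (affine m c g) j * c j l)) *
            Real.exp (t * logSumExp (affine m a g)) +
        softmax (affine m c g) i * (Real.exp (t * logSumExp (affine m a g)) *
          (t * ∑ j, softmax (affine m a g) j * a j l)) with hf'def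
  have c1 := fun j => continuous_softmax_affine m c j
  have c2 := fun j => continuous_softmax_affine m a j
  have c3 := continuous_logSumExp_affine m a
  have hfc : Continuous f := by fun_prop
  have hfc' : ∀ l, Continuous (f' l) := fun l => by fun_prop
  have e1 := fun j => ExpGrowth.softmax m c j
  have e2 := fun j => ExpGrowth.softmax m a j
  have e3 := ExpGrowth.exp_logSumExp m a t
  have hf : ExpGrowth f := (e1 i).mul e3
  have hf' : ∀ l, ExpGrowth (f' l) := by
    intro l
    have s1 : ExpGrowth fun g => ∑ j, softmax (affine m c g) j * c j l :=
      ExpGrowth.sum _ fun j _ => (e1 j).mul (ExpGrowth.const (c j l))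
    have s2 : ExpGrowth fun g => ∑ j, softmax (affine m a g) j * a j l :=
      ExpGrowth.sum _ fun j _ => (e2 j).mul (ExpGrowth.const (a j l))
    have s3 : ExpGrowth fun g => c i l - ∑ j, softmax (affine m c g) j * c j l := by
      refine ((ExpGrowth.const (c i l)).add ((ExpGrowth.const (-1)).mul s1)).mono fun g => ?_
      rw [neg_one_mul, ← sub_eq_add_neg]
    exact (((e1 i).mul s3).mul e3).add ((e1 i).mul (e3.mul ((ExpGrowth.const t).mul s2)))
  have hd : ∀ l g, HasDerivAt (fun s => f (Function.update g l s)) (f' l g) (g l) := by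
    intro l g
    have h1 := hasDerivAt_softmax (fun j => hasDerivAt_affine_update m c g l j) i
    have h2 := ((hasDerivAt_logSumExp
      (fun j => hasDerivAt_affine_update m a g l j)).const_mul t).exp
    have h3 := h1.mul h2
    simp only [Function.update_eq_self] at h3
    exact h3
  have ibp := fun l => integral_eval_mul_stdGauss l hfc (hfc' l) hf (hf' l) (hd l)
  calc ∫ g, (d ⬝ᵥ g) * f g ∂(stdGauss κ)
      = ∫ g, ∑ l, d l * (g l * f g) ∂(stdGauss κ) := by
        congr 1; ext g
        rw [dotProduct, Finset.sum_mul]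
        exact Finset.sum_congr rfl fun l _ => by ring
    _ = ∑ l, d l * ∫ g, f' l g ∂(stdGauss κ) := by
        rw [integral_finsetSum]
        · simp only [integral_const_mul, ibp]
        · intro l _
          exact (((ExpGrowth.eval l).mul hf).integrable_of_continuous
            ((continuous_apply l).mul hfc)).const_mul _
    _ = ∫ g, ∑ l, d l * f' l g ∂(stdGauss κ) := by
        rw [integral_finsetSum]
        · simp only [integral_const_mul]
        · intro l _
          exact ((hf' l).integrable_of_continuous (hfc' l)).const_mul _
    _ = _ := by
        congr 1; ext g
        have sw : ∀ (p : ι → ℝ) (e : ι → κ → ℝ),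
            ∑ j, p j * (e j ⬝ᵥ d) = ∑ l, d l * ∑ j, p j * e j l := by
          intro p e
          simp only [dotProduct, Finset.mul_sum]
          rw [Finset.sum_comm]
          exact Finset.sum_congr rfl fun l _ => Finset.sum_congr rfl fun j _ => by ring
        rw [sw, sw, dotProduct, ← Finset.sum_sub_distrib, Finset.mul_sum, Finset.mul_sum,
          ← Finset.sum_add_distrib, Finset.sum_mul]
        refine Finset.sum_congr rfl fun l _ => ?_
        simp only [hf'def]
        ring

/-- Derivative of the weighted mean of `logSumExp` along a rotation of Gaussian families. -/
theorem hasDerivAt_integral_logSumExp_rotate (m : ι → ℝ) (a b : ι → κ → ℝ) (t θ : ℝ) :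
    HasDerivAt (fun θ => ∫ g, logSumExp (affine m (rotate a b θ) g) *
        Real.exp (t * logSumExp (affine m a g)) ∂(stdGauss κ))
      (∫ g, (∑ i, (softmax (affine m (rotate a b θ) g) i *
          (rotate a b θ i ⬝ᵥ rotate b (-a) θ i -
            ∑ j, softmax (affine m (rotate a b θ) g) j *
              (rotate a b θ j ⬝ᵥ rotate b (-a) θ i)) +
        t * softmax (affine m (rotate a b θ) g) i *
          ∑ j, softmax (affine m a g) j * (a j ⬝ᵥ rotate b (-a) θ i))) *
          Real.exp (t * logSumExp (affine m a g)) ∂(stdGauss κ)) θ := by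
  set W : (κ → ℝ) → ℝ := fun g => Real.exp (t * logSumExp (affine m a g)) with hW
  have cW : Continuous W := by
    have := continuous_logSumExp_affine m a
    fun_prop
  have eW : ExpGrowth W := ExpGrowth.exp_logSumExp m a t
  -- The derivative before integration by parts; `rotate b (-a) θ` is the `θ`-derivative of `rotate
  -- a b θ`.
  set F' : ℝ → (κ → ℝ) → ℝ := fun θ g =>
    (∑ i, softmax (affine m (rotate a b θ) g) i * (rotate b (-a) θ i ⬝ᵥ g)) * W g with hF'
  have cF' : ∀ θ, Continuous (F' θ) := by
    intro θ
    have := fun i => continuous_softmax_affine m (rotate a b θ) i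
    simp only [hF', dotProduct]
    fun_prop
  set B : ℝ := ∑ i, ∑ l, (|b i l| + |a i l|) with hB
  have hbound : ∀ θ g, ‖F' θ g‖ ≤ B * (∑ l, |g l|) * W g := by
    intro θ g
    have hWpos : 0 < W g := Real.exp_pos _
    rw [Real.norm_eq_abs, hF', abs_mul, abs_of_pos hWpos]
    refine mul_le_mul_of_nonneg_right ?_ hWpos.le
    rw [hB, Finset.sum_mul]
    refine (Finset.abs_sum_le_sum_abs _ _).trans (Finset.sum_le_sum fun i _ => ?_)
    rw [abs_mul]
    refine (mul_le_of_le_one_left (abs_nonneg _) (abs_softmax_le_one _ _)).trans ?_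
    have h := abs_affine_le (fun _ => (0 : ℝ)) (rotate b (-a) θ) g i
    simp only [affine, zero_add, abs_zero] at h
    refine h.trans ?_
    gcongr with l _
    simpa using abs_rotate_le b (-a) θ i l
  have main := hasDerivAt_integral_of_dominated_loc_of_deriv_le (μ := stdGauss κ)
    (F := fun θ g => logSumExp (affine m (rotate a b θ) g) * W g) (F' := F') (x₀ := θ)
    (s := Set.univ) (bound := fun g => B * (∑ l, |g l|) * W g) Filter.univ_mem
    (Filter.Eventually.of_forall fun θ =>
      ((continuous_logSumExp_affine m (rotate a b θ)).mul cW).aestronglyMeasurable)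
    (((ExpGrowth.logSumExp m (rotate a b θ)).mul eW).integrable_of_continuous
      ((continuous_logSumExp_affine m (rotate a b θ)).mul cW))
    (cF' θ).aestronglyMeasurable
    (Filter.Eventually.of_forall fun g θ _ => hbound θ g)
    ((((ExpGrowth.const B).mul ExpGrowth.l1).mul eW).integrable_of_continuous (by fun_prop))
    (Filter.Eventually.of_forall fun g θ _ =>
      (hasDerivAt_logSumExp fun i => hasDerivAt_affine_rotate m a b g i θ).mul_const (W g))
  refine main.2.congr_deriv ?_
  have hint : ∀ i, Integrable (fun g => (rotate b (-a) θ i ⬝ᵥ g) *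
      (softmax (affine m (rotate a b θ) g) i * W g)) (stdGauss κ) := by
    intro i
    have := continuous_softmax_affine m (rotate a b θ) i
    refine ((ExpGrowth.dotProduct (rotate b (-a) θ i)).mul
      ((ExpGrowth.softmax m (rotate a b θ) i).mul eW)).integrable_of_continuous ?_
    unfold dotProduct
    fun_prop
  have e1 : ∫ g, F' θ g ∂(stdGauss κ) = ∑ i, ∫ g, (rotate b (-a) θ i ⬝ᵥ g) *
      (softmax (affine m (rotate a b θ) g) i * W g) ∂(stdGauss κ) := by
    rw [← integral_finsetSum _ fun i _ => hint i]
    congr 1; ext g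
    simp only [hF', Finset.sum_mul]
    exact Finset.sum_congr rfl fun i _ => by ring
  rw [e1]
  symm
  simp only [hW, integral_dotProduct_mul_softmax, Finset.sum_mul]
  rw [integral_finsetSum]
  intro i _
  have s0 := fun j => ExpGrowth.softmax m (rotate a b θ) j
  have s1 : ExpGrowth fun g => ∑ j, softmax (affine m (rotate a b θ) g) j *
      (rotate a b θ j ⬝ᵥ rotate b (-a) θ i) :=
    ExpGrowth.sum _ fun j _ => (s0 j).mul (ExpGrowth.const _)
  have s2 : ExpGrowth fun g => ∑ j, softmax (affine m a g) j * (a j ⬝ᵥ rotate b (-a) θ i) :=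
    ExpGrowth.sum _ fun j _ => (ExpGrowth.softmax m a j).mul (ExpGrowth.const _)
  have s3 : ExpGrowth fun g => rotate a b θ i ⬝ᵥ rotate b (-a) θ i -
      ∑ j, softmax (affine m (rotate a b θ) g) j * (rotate a b θ j ⬝ᵥ rotate b (-a) θ i) := by
    refine ((ExpGrowth.const (rotate a b θ i ⬝ᵥ rotate b (-a) θ i)).add
      ((ExpGrowth.const (-1)).mul s1)).mono fun g => ?_
    rw [neg_one_mul, ← sub_eq_add_neg]
  have := fun j => continuous_softmax_affine m (rotate a b θ) j
  have := fun j => continuous_softmax_affine m a j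
  exact ((((s0 i).mul s3).add (((ExpGrowth.const t).mul (s0 i)).mul s2)).mul
    eW).integrable_of_continuous (by fun_prop)

end Interpolation

/-! ### Sudakov–Fernique comparison for finite families. -/

section FiniteComparison

variable {ι κ : Type*}

theorem rotate_zero (a b : ι → κ → ℝ) : rotate a b 0 = a := by
  ext i l; simp [rotate]

theorem rotate_pi_div_two (a b : ι → κ → ℝ) : rotate a b (Real.pi / 2) = b := by
  ext i l; simp [rotate]

variable [Fintype κ]

theorem rotate_dotProduct_rotate (a b : ι → κ → ℝ) (θ : ℝ) (i j : ι) :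
    rotate a b θ j ⬝ᵥ rotate b (-a) θ i =
      Real.cos θ ^ 2 * (a j ⬝ᵥ b i) + Real.cos θ * Real.sin θ * (b j ⬝ᵥ b i - a j ⬝ᵥ a i) -
        Real.sin θ ^ 2 * (b j ⬝ᵥ a i) := by
  simp only [dotProduct, rotate, Pi.neg_apply, ← Finset.sum_sub_distrib, Finset.mul_sum,
    ← Finset.sum_add_distrib]
  exact Finset.sum_congr rfl fun l _ => by ring

theorem dotProduct_rotate (a b : ι → κ → ℝ) (θ : ℝ) (i j : ι) :
    a j ⬝ᵥ rotate b (-a) θ i = Real.cos θ * (a j ⬝ᵥ b i) - Real.sin θ * (a j ⬝ᵥ a i) := by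
  simp only [dotProduct, rotate, Pi.neg_apply, ← Finset.sum_sub_distrib, Finset.mul_sum]
  exact Finset.sum_congr rfl fun l _ => by ring

variable [Fintype ι]

/-- Since the weights sum to one, symmetrizing in `i` and `j` turns twice the sum into an average of
the quantities `D i i + D j j - 2 * D j i`, the form in which increments enter. -/
theorem sum_mul_sub_sum_nonneg {p : ι → ℝ} (hp : ∀ i, 0 ≤ p i) (h1 : ∑ i, p i = 1)
    {D : ι → ι → ℝ} (hD : ∀ i j, 0 ≤ D i i + D j j - 2 * D j i) :
    0 ≤ ∑ i, p i * (D i i - ∑ j, p j * D j i) := by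
  have h : ∑ i, ∑ j, p i * p j * (D i i + D j j - 2 * D j i) =
      2 * ∑ i, p i * (D i i - ∑ j, p j * D j i) := by
    have e1 : ∑ i, ∑ j, p i * p j * D i i = ∑ i, p i * D i i := by
      refine Finset.sum_congr rfl fun i _ => ?_
      rw [← Finset.sum_mul, ← Finset.mul_sum, h1, mul_one]
    have e2 : ∑ i, ∑ j, p i * p j * D j j = ∑ i, p i * D i i := by
      rw [Finset.sum_comm, ← e1]
      exact Finset.sum_congr rfl fun i _ => Finset.sum_congr rfl fun j _ => by ring
    calc _ = ∑ i, ∑ j, p i * p j * D i i + ∑ i, ∑ j, p i * p j * D j j -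
          2 * ∑ i, ∑ j, p i * p j * D j i := by
          simp only [Finset.mul_sum, ← Finset.sum_add_distrib, ← Finset.sum_sub_distrib]
          exact Finset.sum_congr rfl fun i _ => Finset.sum_congr rfl fun j _ => by ring
      _ = _ := by
          have e3 : ∑ i, p i * (D i i - ∑ j, p j * D j i) =
              ∑ i, p i * D i i - ∑ i, ∑ j, p i * p j * D j i := by
            simp only [mul_sub, Finset.sum_sub_distrib, Finset.mul_sum, mul_assoc]
          rw [e1, e2, e3]
          ring
  have h2 : 0 ≤ ∑ i, ∑ j, p i * p j * (D i i + D j j - 2 * D j i) :=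
    Finset.sum_nonneg fun i _ => Finset.sum_nonneg fun j _ =>
      mul_nonneg (mul_nonneg (hp i) (hp j)) (hD i j)
  linarith

variable [Nonempty ι]

/-- The Sudakov–Fernique comparison for `logSumExp`, for families in orthogonal subspaces. -/
theorem integral_logSumExp_le_of_orthogonal (m : ι → ℝ) (a b : ι → κ → ℝ)
    (hab : ∀ i j, a i ⬝ᵥ b j = 0)
    (h : ∀ i j, (a i - a j) ⬝ᵥ (a i - a j) ≤ (b i - b j) ⬝ᵥ (b i - b j)) :
    ∫ g, logSumExp (affine m a g) ∂(stdGauss κ) ≤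
      ∫ g, logSumExp (affine m b g) ∂(stdGauss κ) := by
  have hd := hasDerivAt_integral_logSumExp_rotate m a b 0
  simp only [zero_mul, Real.exp_zero, mul_one, add_zero] at hd
  have hmono : MonotoneOn (fun θ => ∫ g, logSumExp (affine m (rotate a b θ) g) ∂(stdGauss κ))
      (Set.Icc 0 (Real.pi / 2)) := by
    refine monotoneOn_of_deriv_nonneg (convex_Icc _ _)
      (fun θ _ => (hd θ).continuousAt.continuousWithinAt)
      (fun θ _ => (hd θ).differentiableAt.differentiableWithinAt) fun θ hθ => ?_
    rw [interior_Icc] at hθ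
    rw [(hd θ).deriv]
    have hs : 0 ≤ Real.sin θ :=
      Real.sin_nonneg_of_nonneg_of_le_pi hθ.1.le (by linarith [hθ.2, Real.pi_pos])
    have hc : 0 ≤ Real.cos θ :=
      Real.cos_nonneg_of_neg_pi_div_two_le_of_le (by linarith [hθ.1, Real.pi_pos]) hθ.2.le
    refine integral_nonneg fun g => ?_
    refine sum_mul_sub_sum_nonneg (softmax_nonneg _) (sum_softmax _)
      (D := fun j i => rotate a b θ j ⬝ᵥ rotate b (-a) θ i) fun i j => ?_
    -- Orthogonality removes the mixed terms, leaving `cos θ sin θ ≥ 0` times the difference of the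
    -- two covariances.
    have e : ∀ j i, rotate a b θ j ⬝ᵥ rotate b (-a) θ i =
        Real.cos θ * Real.sin θ * (b j ⬝ᵥ b i - a j ⬝ᵥ a i) := fun j i => by
      rw [rotate_dotProduct_rotate, hab, dotProduct_comm (b j) (a i), hab]
      ring
    have hij := h i j
    simp only [sub_dotProduct, dotProduct_sub] at hij
    simp only [e]
    have := mul_nonneg (mul_nonneg hc hs) (sub_nonneg.2 hij)
    rw [dotProduct_comm (a i) (a j), dotProduct_comm (b i) (b j)] at this
    linarith
  have := hmono (Set.left_mem_Icc.2 (by positivity)) (Set.right_mem_Icc.2 (by positivity))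
    (by positivity : (0 : ℝ) ≤ Real.pi / 2)
  simpa only [rotate_zero, rotate_pi_div_two] using this

end FiniteComparison

/-! ### Independent Gaussian blocks. -/

theorem integral_mul_comp_inl_inr {κ κ' : Type*} [Fintype κ] [Fintype κ']
    (f : (κ → ℝ) → ℝ) (h : (κ' → ℝ) → ℝ) :
    ∫ g, f (g ∘ Sum.inl) * h (g ∘ Sum.inr) ∂(stdGauss (κ ⊕ κ')) =
      (∫ g, f g ∂(stdGauss κ)) * ∫ g, h g ∂(stdGauss κ') := by
  have mp := measurePreserving_sumPiEquivProdPi (X := fun _ : κ ⊕ κ' => ℝ)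
    (fun _ => gaussianReal 0 1)
  have := mp.integral_comp' (fun p : (κ → ℝ) × (κ' → ℝ) => f p.1 * h p.2)
  rw [integral_prod_mul] at this
  exact this

theorem integral_comp_inl {κ κ' : Type*} [Fintype κ] [Fintype κ'] (f : (κ → ℝ) → ℝ) :
    ∫ g, f (g ∘ Sum.inl) ∂(stdGauss (κ ⊕ κ')) = ∫ g, f g ∂(stdGauss κ) := by
  simpa using integral_mul_comp_inl_inr f fun _ : κ' → ℝ => 1

theorem integral_comp_inr {κ κ' : Type*} [Fintype κ] [Fintype κ'] (h : (κ' → ℝ) → ℝ) :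
    ∫ g, h (g ∘ Sum.inr) ∂(stdGauss (κ ⊕ κ')) = ∫ g, h g ∂(stdGauss κ') := by
  simpa using integral_mul_comp_inl_inr (fun _ : κ → ℝ => 1) h

theorem affine_elim_left {ι κ κ' : Type*} [Fintype κ] [Fintype κ'] (m : ι → ℝ) (c : ι → κ → ℝ)
    (g : κ ⊕ κ' → ℝ) :
    affine m (fun i => Sum.elim (c i) 0) g = affine m c (g ∘ Sum.inl) := by
  ext i
  simp [affine, dotProduct]

theorem affine_elim_right {ι κ κ' : Type*} [Fintype κ] [Fintype κ'] (m : ι → ℝ) (c : ι → κ' → ℝ)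
    (g : κ ⊕ κ' → ℝ) :
    affine m (fun i => Sum.elim 0 (c i)) g = affine m c (g ∘ Sum.inr) := by
  ext i
  simp [affine, dotProduct]

/-! ### General finite comparison and the moment generating function. -/

section FiniteConcentration

variable {ι κ κ' : Type*} [Fintype ι] [Nonempty ι] [Fintype κ] [Fintype κ']

/-- The Sudakov–Fernique comparison for `logSumExp`. -/
theorem integral_logSumExp_le (m : ι → ℝ) (a : ι → κ → ℝ) (b : ι → κ' → ℝ)
    (h : ∀ i j, (a i - a j) ⬝ᵥ (a i - a j) ≤ (b i - b j) ⬝ᵥ (b i - b j)) :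
    ∫ g, logSumExp (affine m a g) ∂(stdGauss κ) ≤
      ∫ g, logSumExp (affine m b g) ∂(stdGauss κ') := by
  -- Disjoint coordinate blocks make the families orthogonal without changing their laws.
  have := integral_logSumExp_le_of_orthogonal m (fun i => Sum.elim (a i) (0 : κ' → ℝ))
    (fun i => Sum.elim (0 : κ → ℝ) (b i)) (fun i j => by simp [dotProduct])
    (fun i j => by simpa [dotProduct] using h i j)
  simpa only [affine_elim_left, affine_elim_right,
    integral_comp_inl (fun g => logSumExp (affine m a g)),
    integral_comp_inr (fun g => logSumExp (affine m b g))] using this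

/-- Rotate the family into an independent copy of itself. The integral moves from `E[H exp (t H)]`
to `E[H] E[exp (t H)]`, and its derivative is at most `|t| v E[exp (t H)] sin θ` in absolute value;
the integral of `sin` over `[0, π/2]` is `1`. -/
theorem abs_covariance_logSumExp_exp_le (m : ι → ℝ) (a : ι → κ → ℝ) {v : ℝ}
    (hv : ∀ i j, |a i ⬝ᵥ a j| ≤ v) (t : ℝ) :
    |∫ g, logSumExp (affine m a g) * Real.exp (t * logSumExp (affine m a g)) ∂(stdGauss κ) -
        (∫ g, logSumExp (affine m a g) ∂(stdGauss κ)) *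
          ∫ g, Real.exp (t * logSumExp (affine m a g)) ∂(stdGauss κ)| ≤
      |t| * v * ∫ g, Real.exp (t * logSumExp (affine m a g)) ∂(stdGauss κ) := by
  set a' : ι → κ ⊕ κ → ℝ := fun i => Sum.elim (a i) 0 with ha'
  set b' : ι → κ ⊕ κ → ℝ := fun i => Sum.elim 0 (a i) with hb'
  have hab : ∀ i j, a' i ⬝ᵥ b' j = 0 := fun i j => by simp [ha', hb', dotProduct]
  have haa : ∀ i j, a' i ⬝ᵥ a' j = a i ⬝ᵥ a j := fun i j => by simp [ha', dotProduct]
  have hbb : ∀ i j, b' i ⬝ᵥ b' j = a i ⬝ᵥ a j := fun i j => by simp [hb', dotProduct]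
  have hd := hasDerivAt_integral_logSumExp_rotate m a' b' t
  set Φ : ℝ → ℝ := fun θ => ∫ g, logSumExp (affine m (rotate a' b' θ) g) *
    Real.exp (t * logSumExp (affine m a' g)) ∂(stdGauss (κ ⊕ κ)) with hΦ
  set ψ : ℝ := ∫ g, Real.exp (t * logSumExp (affine m a g)) ∂(stdGauss κ) with hψ
  have hψ' : ψ = ∫ g, Real.exp (t * logSumExp (affine m a' g)) ∂(stdGauss (κ ⊕ κ)) := by
    simp only [ha', affine_elim_left]
    exact (integral_comp_inl fun g => Real.exp (t * logSumExp (affine m a g))).symm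
  have hderiv : ∀ θ ∈ Set.Icc 0 (Real.pi / 2), |deriv Φ θ| ≤ |t| * v * ψ * Real.sin θ := by
    intro θ hθ
    have hs : 0 ≤ Real.sin θ :=
      Real.sin_nonneg_of_nonneg_of_le_pi hθ.1 (by linarith [hθ.2, Real.pi_pos])
    rw [(hd θ).deriv, hψ', ← integral_const_mul, ← integral_mul_const, ← Real.norm_eq_abs]
    refine norm_integral_le_of_norm_le (g := fun g => |t| * v *
      Real.exp (t * logSumExp (affine m a' g)) * Real.sin θ) ?_ ?_
    · have := continuous_logSumExp_affine m a'
      exact ((((ExpGrowth.exp_logSumExp m a' t).integrable_of_continuous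
        (by fun_prop)).const_mul _).mul_const _)
    · refine Filter.Eventually.of_forall fun g => ?_
      set p := softmax (affine m (rotate a' b' θ) g)
      set q := softmax (affine m a' g)
      have hE := Real.exp_pos (t * logSumExp (affine m a' g))
      -- The rotated family has constant covariance, so only the part coming from the exponential
      -- weight survives.
      have e1 : ∀ j i, rotate a' b' θ j ⬝ᵥ rotate b' (-a') θ i = 0 := fun j i => by
        rw [rotate_dotProduct_rotate, hab, dotProduct_comm (b' j) (a' i), hab, haa, hbb]
        ring
      have e2 : ∀ j i, a' j ⬝ᵥ rotate b' (-a') θ i = -(Real.sin θ * (a j ⬝ᵥ a i)) :=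
        fun j i => by
          rw [dotProduct_rotate, hab, haa]
          ring
      rw [Real.norm_eq_abs, abs_mul, abs_of_pos hE]
      have hb : |∑ i, (p i * (rotate a' b' θ i ⬝ᵥ rotate b' (-a') θ i -
            ∑ j, p j * (rotate a' b' θ j ⬝ᵥ rotate b' (-a') θ i)) +
          t * p i * ∑ j, q j * (a' j ⬝ᵥ rotate b' (-a') θ i))| ≤ |t| * v * Real.sin θ := by
        simp only [e1, e2, mul_zero, Finset.sum_const_zero, sub_zero, zero_add]
        have hq : ∀ i, |∑ j, q j * -(Real.sin θ * (a j ⬝ᵥ a i))| ≤ v * Real.sin θ := by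
          intro i
          refine (Finset.abs_sum_le_sum_abs _ _).trans ?_
          rw [← one_mul (v * Real.sin θ), ← sum_softmax (affine m a' g), Finset.sum_mul]
          refine Finset.sum_le_sum fun j _ => ?_
          rw [abs_mul, abs_of_nonneg (softmax_nonneg _ j), abs_neg, abs_mul, abs_of_nonneg hs,
            mul_comm v]
          exact mul_le_mul_of_nonneg_left (mul_le_mul_of_nonneg_left (hv j i) hs)
            (softmax_nonneg _ j)
        refine (Finset.abs_sum_le_sum_abs _ _).trans ?_
        rw [← one_mul (|t| * v * Real.sin θ), ← sum_softmax (affine m (rotate a' b' θ) g),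
          Finset.sum_mul]
        refine Finset.sum_le_sum fun i _ => ?_
        rw [abs_mul, abs_mul, abs_of_nonneg (softmax_nonneg _ i)]
        calc |t| * p i * |∑ j, q j * -(Real.sin θ * (a j ⬝ᵥ a i))|
            ≤ |t| * p i * (v * Real.sin θ) :=
              mul_le_mul_of_nonneg_left (hq i)
                (mul_nonneg (abs_nonneg _) (softmax_nonneg _ i))
          _ = _ := by ring
      calc _ ≤ |t| * v * Real.sin θ * Real.exp (t * logSumExp (affine m a' g)) :=
            mul_le_mul_of_nonneg_right hb hE.le
        _ = _ := by ring
  have h0 : Φ 0 =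
      ∫ g, logSumExp (affine m a g) * Real.exp (t * logSumExp (affine m a g)) ∂(stdGauss κ) := by
    simp only [hΦ, rotate_zero, ha', affine_elim_left]
    exact integral_comp_inl fun g =>
      logSumExp (affine m a g) * Real.exp (t * logSumExp (affine m a g))
  have h1 : Φ (Real.pi / 2) = (∫ g, logSumExp (affine m a g) ∂(stdGauss κ)) * ψ := by
    simp only [hΦ, rotate_pi_div_two, ha', hb', affine_elim_left, affine_elim_right]
    rw [mul_comm _ ψ, hψ, ← integral_mul_comp_inl_inr]
    simp only [mul_comm]
  rw [← h0, ← h1]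
  have hpi : (0 : ℝ) ≤ Real.pi / 2 := by positivity
  have hΦd : Differentiable ℝ Φ := fun θ => (hd θ).differentiableAt
  -- Integrating the bound on `Φ'` is done by monotonicity of `Φ` corrected by a multiple of `cos`,
  -- in both directions.
  have hcos : ∀ c θ : ℝ, HasDerivAt (fun θ => Φ θ + c * Real.cos θ)
      (deriv Φ θ + c * -Real.sin θ) θ := fun c θ =>
    (hΦd θ).hasDerivAt.add ((Real.hasDerivAt_cos θ).const_mul c)
  have hA := antitoneOn_of_deriv_nonpos (convex_Icc 0 (Real.pi / 2))
    (f := fun θ => Φ θ + (|t| * v * ψ) * Real.cos θ)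
    (fun θ _ => (hcos _ θ).continuousAt.continuousWithinAt)
    (fun θ _ => (hcos _ θ).differentiableAt.differentiableWithinAt) fun θ hθ => by
      rw [(hcos _ θ).deriv]
      have := (abs_le.1 (hderiv θ (interior_subset hθ))).2
      linarith
  have hB := monotoneOn_of_deriv_nonneg (convex_Icc 0 (Real.pi / 2))
    (f := fun θ => Φ θ + (-(|t| * v * ψ)) * Real.cos θ)
    (fun θ _ => (hcos _ θ).continuousAt.continuousWithinAt)
    (fun θ _ => (hcos _ θ).differentiableAt.differentiableWithinAt) fun θ hθ => by
      rw [(hcos _ θ).deriv]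
      have := (abs_le.1 (hderiv θ (interior_subset hθ))).1
      linarith
  have hA' := hA (Set.left_mem_Icc.2 hpi) (Set.right_mem_Icc.2 hpi) hpi
  have hB' := hB (Set.left_mem_Icc.2 hpi) (Set.right_mem_Icc.2 hpi) hpi
  simp only [Real.cos_zero, Real.cos_pi_div_two] at hA' hB'
  exact abs_le.2 ⟨by linarith, by linarith⟩

/-- The sharp Gaussian bound on the moment generating function of `logSumExp`. -/
theorem integral_exp_logSumExp_le (m : ι → ℝ) (a : ι → κ → ℝ) {v : ℝ}
    (hv : ∀ i j, |a i ⬝ᵥ a j| ≤ v) (t : ℝ) :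
    ∫ g, Real.exp (t * logSumExp (affine m a g)) ∂(stdGauss κ) ≤
      Real.exp (t * ∫ g, logSumExp (affine m a g) ∂(stdGauss κ) + v * t ^ 2 / 2) := by
  set H : (κ → ℝ) → ℝ := fun g => logSumExp (affine m a g) with hH
  have hcont : Continuous H := continuous_logSumExp_affine m a
  have hint : ∀ t, Integrable (fun g => Real.exp (t * H g)) (stdGauss κ) := fun t =>
    (ExpGrowth.exp_logSumExp m a t).integrable_of_continuous
      (Real.continuous_exp.comp (continuous_const.mul hcont))
  have huniv : integrableExpSet H (stdGauss κ) = Set.univ :=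
    Set.eq_univ_of_forall fun t => hint t
  have hpos : ∀ t, 0 < mgf H (stdGauss κ) t := fun t => mgf_pos (hint t)
  set e : ℝ := ∫ g, H g ∂(stdGauss κ) with he
  set D : ℝ → ℝ := fun t => (∫ g, H g * Real.exp (t * H g) ∂(stdGauss κ)) /
    mgf H (stdGauss κ) t with hD
  -- Herbst's argument: the log moment generating function minus the target vanishes at `0`, and the
  -- covariance bound makes it decrease away from `0` on both sides.
  have hd : ∀ t, HasDerivAt (fun t => Real.log (mgf H (stdGauss κ) t) - t * e - v * t ^ 2 / 2)
      (D t - e - v * t) t := by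
    intro t
    have h1 := (hasDerivAt_mgf (X := H) (μ := stdGauss κ) (t := t)
      (by rw [huniv]; simp)).log (hpos t).ne'
    refine ((h1.sub ((hasDerivAt_id t).mul_const e)).sub
      (((hasDerivAt_pow 2 t).const_mul v).div_const 2)).congr_deriv ?_
    simp only [hD]
    ring
  have hDb : ∀ t, |D t - e| ≤ |t| * v := by
    intro t
    have h := abs_covariance_logSumExp_exp_le m a hv t
    have h2 : D t - e = (∫ g, H g * Real.exp (t * H g) ∂(stdGauss κ) -
        e * mgf H (stdGauss κ) t) / mgf H (stdGauss κ) t := by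
      rw [sub_div, mul_div_cancel_right₀ _ (hpos t).ne']
    rw [h2, abs_div, abs_of_pos (hpos t), div_le_iff₀ (hpos t)]
    exact h
  set r : ℝ → ℝ := fun t => Real.log (mgf H (stdGauss κ) t) - t * e - v * t ^ 2 / 2 with hr
  have hr0 : r 0 = 0 := by simp [hr]
  have hrt : r t ≤ 0 := by
    rcases le_total 0 t with ht | ht
    · have hA : AntitoneOn r (Set.Ici 0) := antitoneOn_of_deriv_nonpos (convex_Ici 0)
        (fun θ _ => (hd θ).continuousAt.continuousWithinAt)
        (fun θ _ => (hd θ).differentiableAt.differentiableWithinAt) fun s hs => by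
          rw [(hd s).deriv]
          have h := (abs_le.1 (hDb s)).2
          rw [abs_of_nonneg (interior_subset (s := Set.Ici (0 : ℝ)) hs)] at h
          linarith
      rw [← hr0]
      exact hA Set.self_mem_Ici ht ht
    · have hA : MonotoneOn r (Set.Iic 0) := monotoneOn_of_deriv_nonneg (convex_Iic 0)
        (fun θ _ => (hd θ).continuousAt.continuousWithinAt)
        (fun θ _ => (hd θ).differentiableAt.differentiableWithinAt) fun s hs => by
          rw [(hd s).deriv]
          have h := (abs_le.1 (hDb s)).1
          rw [abs_of_nonpos (interior_subset (s := Set.Iic (0 : ℝ)) hs)] at h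
          linarith
      rw [← hr0]
      exact hA ht Set.self_mem_Iic ht
  change mgf H (stdGauss κ) t ≤ _
  rw [← Real.log_le_iff_le_exp (hpos t)]
  simp only [hr] at hrt
  linarith

end FiniteConcentration

/-! ### From finite families to suprema. -/

section SmoothMax

open Filter Topology

variable {κ κ' : Type*} [Fintype κ] [Fintype κ']

/-- A smooth approximation, at inverse temperature `N + 1`, of the maximum of the first `N + 1`
functions in a sequence of affine functions. -/
noncomputable def smoothMax (m : ℕ → ℝ) (a : ℕ → κ → ℝ) (N : ℕ) (g : κ → ℝ) : ℝ :=
  ((N : ℝ) + 1)⁻¹ * logSumExp (affine (fun i : Fin (N + 1) => ((N : ℝ) + 1) * m i)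
    (fun i => ((N : ℝ) + 1) • a i) g)

theorem affine_smul (N : ℕ) (m : ℕ → ℝ) (a : ℕ → κ → ℝ) (g : κ → ℝ) (i : Fin (N + 1)) :
    affine (fun i : Fin (N + 1) => ((N : ℝ) + 1) * m i) (fun i => ((N : ℝ) + 1) • a i) g i =
      ((N : ℝ) + 1) * (m i + a i ⬝ᵥ g) := by
  rw [affine, smul_dotProduct, smul_eq_mul, mul_add]

theorem le_smoothMax (m : ℕ → ℝ) (a : ℕ → κ → ℝ) {N i : ℕ} (hi : i ≤ N) (g : κ → ℝ) :
    m i + a i ⬝ᵥ g ≤ smoothMax m a N g := by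
  have hN : (0 : ℝ) < (N : ℝ) + 1 := by positivity
  rw [smoothMax, le_inv_mul_iff₀ hN]
  have := le_logSumExp (affine (fun i : Fin (N + 1) => ((N : ℝ) + 1) * m i)
    (fun i => ((N : ℝ) + 1) • a i) g) ⟨i, by omega⟩
  rwa [affine_smul] at this

theorem smoothMax_le {m : ℕ → ℝ} {a : ℕ → κ → ℝ} {g : κ → ℝ} {c : ℝ}
    (hc : ∀ i, m i + a i ⬝ᵥ g ≤ c) (N : ℕ) :
    smoothMax m a N g ≤ Real.log ((N : ℝ) + 1) / ((N : ℝ) + 1) + c := by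
  have hN : (0 : ℝ) < (N : ℝ) + 1 := by positivity
  have := logSumExp_le (s := affine (fun i : Fin (N + 1) => ((N : ℝ) + 1) * m i)
    (fun i => ((N : ℝ) + 1) • a i) g) (c := ((N : ℝ) + 1) * c) fun i => by
      rw [affine_smul]
      exact mul_le_mul_of_nonneg_left (hc i) hN.le
  rw [smoothMax, inv_mul_le_iff₀ hN, mul_add, mul_div_cancel₀ _ hN.ne']
  simpa using this

theorem tendsto_log_div_atTop :
    Tendsto (fun N : ℕ => Real.log ((N : ℝ) + 1) / ((N : ℝ) + 1)) atTop (𝓝 0) :=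
  Real.isLittleO_log_id_atTop.tendsto_div_nhds_zero.comp
    (tendsto_atTop_add_const_right _ 1 tendsto_natCast_atTop_atTop)

theorem continuous_smoothMax (m : ℕ → ℝ) (a : ℕ → κ → ℝ) (N : ℕ) :
    Continuous (smoothMax m a N) :=
  continuous_const.mul (continuous_logSumExp_affine _ _)

theorem integrable_smoothMax (m : ℕ → ℝ) (a : ℕ → κ → ℝ) (N : ℕ) :
    Integrable (smoothMax m a N) (stdGauss κ) :=
  ((ExpGrowth.const _).mul (ExpGrowth.logSumExp _ _)).integrable_of_continuous
    (continuous_smoothMax m a N)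

theorem integral_smoothMax_le (m : ℕ → ℝ) (a : ℕ → κ → ℝ) (b : ℕ → κ' → ℝ)
    (h : ∀ i j, (a i - a j) ⬝ᵥ (a i - a j) ≤ (b i - b j) ⬝ᵥ (b i - b j)) (N : ℕ) :
    ∫ g, smoothMax m a N g ∂(stdGauss κ) ≤ ∫ g, smoothMax m b N g ∂(stdGauss κ') := by
  unfold smoothMax
  rw [integral_const_mul, integral_const_mul]
  refine mul_le_mul_of_nonneg_left (integral_logSumExp_le _ _ _ fun i j => ?_) (by positivity)
  simp only [← smul_sub, smul_dotProduct, dotProduct_smul, smul_eq_mul]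
  have := h i j
  gcongr

theorem integral_exp_smoothMax_le (m : ℕ → ℝ) (a : ℕ → κ → ℝ) {v : ℝ}
    (hv : ∀ i j, |a i ⬝ᵥ a j| ≤ v) (N : ℕ) (t : ℝ) :
    ∫ g, Real.exp (t * smoothMax m a N g) ∂(stdGauss κ) ≤
      Real.exp (t * ∫ g, smoothMax m a N g ∂(stdGauss κ) + v * t ^ 2 / 2) := by
  have hN : (0 : ℝ) < (N : ℝ) + 1 := by positivity
  unfold smoothMax
  rw [integral_const_mul]
  -- Scaling the coefficients by `N + 1` multiplies covariances by `(N + 1) ^ 2`; evaluating at `t /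
  -- (N + 1)` cancels this exactly.
  have := integral_exp_logSumExp_le (fun i : Fin (N + 1) => ((N : ℝ) + 1) * m i)
    (fun i => ((N : ℝ) + 1) • a i) (v := ((N : ℝ) + 1) ^ 2 * v) (fun i j => by
      rw [smul_dotProduct, dotProduct_smul, smul_eq_mul, smul_eq_mul, ← mul_assoc, ← pow_two,
        abs_mul, abs_of_pos (by positivity)]
      exact mul_le_mul_of_nonneg_left (hv i j) (by positivity)) (t * ((N : ℝ) + 1)⁻¹)
  convert this using 2
  · simp only [mul_assoc]
  · field_simp

theorem mul_le_of_abs_le {t x C K S : ℝ} (hx : |x| ≤ C + K * S) :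
    t * x ≤ |t| * C + |t| * K * S := by
  calc t * x ≤ |t| * |x| := by rw [← abs_mul]; exact le_abs_self _
    _ ≤ |t| * (C + K * S) := mul_le_mul_of_nonneg_left hx (abs_nonneg _)
    _ = _ := by ring

section Supremum

variable {m : ℕ → ℝ} {a : ℕ → κ → ℝ} {h : (κ → ℝ) → ℝ}

theorem tendsto_smoothMax
    (hh : ∀ g, IsLUB (Set.range fun i => m i + a i ⬝ᵥ g) (h g))
    (g : κ → ℝ) :
    Tendsto (fun N => smoothMax m a N g) atTop (𝓝 (h g)) := by
  have hub : ∀ i, m i + a i ⬝ᵥ g ≤ h g := fun i => (hh g).1 ⟨i, rfl⟩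
  refine tendsto_order.2 ⟨fun x hx => ?_, fun x hx => ?_⟩
  · obtain ⟨_, ⟨i, rfl⟩, hi, -⟩ := (hh g).exists_between hx
    filter_upwards [eventually_ge_atTop i] with N hN
    exact hi.trans_le (le_smoothMax m a hN g)
  · have h1 := tendsto_log_div_atTop.add_const (h g)
    rw [zero_add] at h1
    filter_upwards [(tendsto_order.1 h1).2 x hx] with N hN
    exact (smoothMax_le hub N).trans_lt hN

theorem measurable_sup_affine
    (hh : ∀ g, IsLUB (Set.range fun i => m i + a i ⬝ᵥ g) (h g))
    : Measurable h :=
  measurable_of_tendsto_metrizable (fun N => (continuous_smoothMax m a N).measurable)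
    (tendsto_pi_nhds.2 (tendsto_smoothMax hh))

/-- A bound uniform in `N`, used for dominated convergence. The value `h 0` dominates every `m i`,
and `√v` every coordinate of every `a i`. -/
theorem abs_smoothMax_le {v : ℝ}
    (hh : ∀ g, IsLUB (Set.range fun i => m i + a i ⬝ᵥ g) (h g))
    (hv : ∀ i j, |a i ⬝ᵥ a j| ≤ v) (N : ℕ) (g : κ → ℝ) :
    |smoothMax m a N g| ≤ (1 + |h 0| + |m 0|) + √v * ∑ l, |g l| := by
  have hcoord : ∀ i l, |a i l| ≤ √v := by
    intro i l
    refine Real.abs_le_sqrt (le_trans ?_ ((le_abs_self _).trans (hv i i)))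
    rw [pow_two, dotProduct]
    exact Finset.single_le_sum (f := fun l => a i l * a i l) (fun _ _ => mul_self_nonneg _)
      (Finset.mem_univ l)
  have hdot : ∀ i, |a i ⬝ᵥ g| ≤ √v * ∑ l, |g l| := by
    intro i
    rw [dotProduct, Finset.mul_sum]
    refine (Finset.abs_sum_le_sum_abs _ _).trans (Finset.sum_le_sum fun l _ => ?_)
    rw [abs_mul]
    exact mul_le_mul_of_nonneg_right (hcoord i l) (abs_nonneg _)
  have hm : ∀ i, m i ≤ h 0 := fun i => (hh 0).1 ⟨i, by simp⟩
  have hlog : Real.log ((N : ℝ) + 1) / ((N : ℝ) + 1) ≤ 1 := by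
    rw [div_le_one (by positivity)]
    exact Real.log_le_self (by positivity)
  have hup : ∀ i, m i + a i ⬝ᵥ g ≤ h 0 + √v * ∑ l, |g l| := fun i =>
    add_le_add (hm i) ((le_abs_self _).trans (hdot i))
  have h1 := smoothMax_le hup N
  have h2 := le_smoothMax m a (Nat.zero_le N) g
  have h3 := (abs_le.1 (hdot 0)).1
  have h4 := neg_abs_le (m 0)
  have h5 := le_abs_self (h 0)
  have h6 := abs_nonneg (h 0)
  have h7 := abs_nonneg (m 0)
  exact abs_le.2 ⟨by linarith, by linarith⟩

theorem abs_sup_affine_le {v : ℝ}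
    (hh : ∀ g, IsLUB (Set.range fun i => m i + a i ⬝ᵥ g) (h g))
    (hv : ∀ i j, |a i ⬝ᵥ a j| ≤ v) (g : κ → ℝ) :
    |h g| ≤ (1 + |h 0| + |m 0|) + √v * ∑ l, |g l| :=
  le_of_tendsto (tendsto_smoothMax hh g).abs
    (Eventually.of_forall fun N => abs_smoothMax_le hh hv N g)

theorem integrable_sup_affine {v : ℝ}
    (hh : ∀ g, IsLUB (Set.range fun i => m i + a i ⬝ᵥ g) (h g))
    (hv : ∀ i j, |a i ⬝ᵥ a j| ≤ v) : Integrable h (stdGauss κ) := by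
  refine ExpGrowth.integrable ?_ (measurable_sup_affine hh).aestronglyMeasurable
  refine ((ExpGrowth.const (1 + |h 0| + |m 0|)).add
    ((ExpGrowth.const √v).mul ExpGrowth.l1)).mono fun g => ?_
  exact (abs_sup_affine_le hh hv g).trans (le_abs_self _)

theorem tendsto_integral_smoothMax {v : ℝ}
    (hh : ∀ g, IsLUB (Set.range fun i => m i + a i ⬝ᵥ g) (h g))
    (hv : ∀ i j, |a i ⬝ᵥ a j| ≤ v) :
    Tendsto (fun N => ∫ g, smoothMax m a N g ∂(stdGauss κ)) atTop
      (𝓝 (∫ g, h g ∂(stdGauss κ))) :=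
  tendsto_integral_of_dominated_convergence _
    (fun N => (continuous_smoothMax m a N).aestronglyMeasurable)
    (((ExpGrowth.const (1 + |h 0| + |m 0|)).add
      ((ExpGrowth.const √v).mul ExpGrowth.l1)).integrable_of_continuous (by fun_prop))
    (fun N => Eventually.of_forall fun g => abs_smoothMax_le hh hv N g)
    (Eventually.of_forall fun g => tendsto_smoothMax hh g)

/-- Sharp sub-Gaussian concentration of a supremum of affine functions of a standard Gaussian
vector. -/
theorem hasSubgaussianMGF_sup_affine {v : ℝ}
    (hh : ∀ g, IsLUB (Set.range fun i => m i + a i ⬝ᵥ g) (h g))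
    (hv : ∀ i j, |a i ⬝ᵥ a j| ≤ v) :
    HasSubgaussianMGF (fun g => h g - ∫ g', h g' ∂(stdGauss κ)) v.toNNReal (stdGauss κ) := by
  have hv0 : 0 ≤ v := (abs_nonneg _).trans (hv 0 0)
  set e := ∫ g', h g' ∂(stdGauss κ) with he
  have hbi : ∀ t, Integrable (fun g : κ → ℝ => Real.exp (|t| * (1 + |h 0| + |m 0|) +
      |t| * √v * ∑ l, |g l|)) (stdGauss κ) := fun t =>
    (ExpGrowth.exp_of_le (|t| * (1 + |h 0| + |m 0|)) (|t| * √v) (by positivity)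
      fun g => le_rfl).integrable_of_continuous (by fun_prop)
  have hexp : ∀ t, Tendsto (fun N => ∫ g, Real.exp (t * smoothMax m a N g) ∂(stdGauss κ)) atTop
      (𝓝 (∫ g, Real.exp (t * h g) ∂(stdGauss κ))) := by
    intro t
    refine tendsto_integral_of_dominated_convergence _ (fun N => ?_) (hbi t)
      (fun N => Eventually.of_forall fun g => ?_) (Eventually.of_forall fun g => ?_)
    · exact (Real.continuous_exp.comp
        (continuous_const.mul (continuous_smoothMax m a N))).aestronglyMeasurable
    · rw [Real.norm_eq_abs, abs_of_pos (Real.exp_pos _)]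
      exact Real.exp_le_exp.2 (mul_le_of_abs_le (abs_smoothMax_le hh hv N g))
    · exact (Real.continuous_exp.tendsto _).comp ((tendsto_smoothMax hh g).const_mul t)
  have hle : ∀ t, ∫ g, Real.exp (t * h g) ∂(stdGauss κ) ≤ Real.exp (t * e + v * t ^ 2 / 2) := by
    intro t
    refine le_of_tendsto_of_tendsto' (hexp t) ((Real.continuous_exp.tendsto _).comp
      (((tendsto_integral_smoothMax hh hv).const_mul t).add_const (v * t ^ 2 / 2)))
      fun N => integral_exp_smoothMax_le m a hv N t
  have hsplit : ∀ t g, Real.exp (t * (h g - e)) = Real.exp (-(t * e)) * Real.exp (t * h g) := by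
    intro t g
    rw [← Real.exp_add]
    ring_nf
  have hmeas := measurable_sup_affine hh
  refine ⟨fun t => ?_, fun t => ?_⟩
  · simp only [hsplit]
    refine Integrable.const_mul ?_ _
    refine (hbi t).mono' (by fun_prop) (Eventually.of_forall fun g => ?_)
    rw [Real.norm_eq_abs, abs_of_pos (Real.exp_pos _)]
    exact Real.exp_le_exp.2 (mul_le_of_abs_le (abs_sup_affine_le hh hv g))
  · rw [mgf]
    simp only [hsplit, integral_const_mul, Real.coe_toNNReal v hv0]
    calc _ ≤ Real.exp (-(t * e)) * Real.exp (t * e + v * t ^ 2 / 2) :=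
          mul_le_mul_of_nonneg_left (hle t) (Real.exp_pos _).le
      _ = _ := by rw [← Real.exp_add]; ring_nf

theorem measureReal_abs_sub_integral_sup_affine_le {v : ℝ}
    (hh : ∀ g, IsLUB (Set.range fun i => m i + a i ⬝ᵥ g) (h g))
    (hv : ∀ i j, |a i ⬝ᵥ a j| ≤ v) {s : ℝ} (hs : 0 ≤ s) :
    (stdGauss κ).real {g | s ≤ |h g - ∫ g', h g' ∂(stdGauss κ)|} ≤
      2 * Real.exp (-(s ^ 2 / (2 * v))) := by
  have hv0 : 0 ≤ v := (abs_nonneg _).trans (hv 0 0)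
  have h1 := hasSubgaussianMGF_sup_affine hh hv
  have h2 := h1.measure_ge_le hs
  have h3 := h1.neg.measure_ge_le hs
  rw [Real.coe_toNNReal v hv0, neg_div] at h2 h3
  have hsub : {g | s ≤ |h g - ∫ g', h g' ∂(stdGauss κ)|} ⊆
      {g | s ≤ h g - ∫ g', h g' ∂(stdGauss κ)} ∪
        {g | s ≤ (-fun g => h g - ∫ g', h g' ∂(stdGauss κ)) g} := by
    intro g hg
    simp only [Set.mem_ofPred_eq, Set.mem_union, Pi.neg_apply] at hg ⊢
    exact le_abs.1 hg
  calc _ ≤ _ := measureReal_mono hsub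
    _ ≤ _ := measureReal_union_le _ _
    _ ≤ _ := add_le_add h2 h3
    _ = _ := by ring

/-- The Sudakov–Fernique inequality: the mean of a supremum of affine functions of a Gaussian
vector is at most the mean of an upper bound for a family with larger increments. -/
theorem integral_sup_affine_le {v : ℝ}
    (hh : ∀ g, IsLUB (Set.range fun i => m i + a i ⬝ᵥ g) (h g))
    (hv : ∀ i j, |a i ⬝ᵥ a j| ≤ v) {b : ℕ → κ' → ℝ}
    (hab : ∀ i j, (a i - a j) ⬝ᵥ (a i - a j) ≤ (b i - b j) ⬝ᵥ (b i - b j))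
    {R : (κ' → ℝ) → ℝ} (hR : Integrable R (stdGauss κ'))
    (hbR : ∀ i g, m i + b i ⬝ᵥ g ≤ R g) :
    ∫ g, h g ∂(stdGauss κ) ≤ ∫ g, R g ∂(stdGauss κ') := by
  have h1 := tendsto_log_div_atTop.add_const (∫ g, R g ∂(stdGauss κ'))
  rw [zero_add] at h1
  refine le_of_tendsto_of_tendsto' (tendsto_integral_smoothMax hh hv) h1 fun N => ?_
  refine (integral_smoothMax_le m a b hab N).trans ?_
  have h2 : ∫ g, (Real.log ((N : ℝ) + 1) / ((N : ℝ) + 1) + R g) ∂(stdGauss κ') =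
      Real.log ((N : ℝ) + 1) / ((N : ℝ) + 1) + ∫ g, R g ∂(stdGauss κ') := by
    rw [integral_add (integrable_const _) hR]
    simp
  rw [← h2]
  exact integral_mono (integrable_smoothMax m b N) ((integrable_const _).add hR)
    fun g => smoothMax_le (fun i => hbR i g) N

end Supremum

end SmoothMax

/-! ### Banach's theorem on symmetric multilinear forms. -/

section Banach

variable {ι E : Type*} [Fintype ι] [NormedAddCommGroup E] [InnerProductSpace ℝ E]

theorem abs_multilinear_le_mul_prod_norm (M : MultilinearMap ℝ (fun _ : ι => E) ℝ) {C : ℝ}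
    (hC : ∀ u : ι → E, (∀ j, ‖u j‖ = 1) → |M u| ≤ C) (u : ι → E) :
    |M u| ≤ C * ∏ j, ‖u j‖ := by
  by_cases h0 : ∃ j, u j = 0
  · obtain ⟨j, hj⟩ := h0
    rw [M.map_coord_zero j hj, Finset.prod_eq_zero (Finset.mem_univ j) (by simp [hj])]
    simp
  · push Not at h0
    have hn : ∀ j, ‖u j‖ ≠ 0 := fun j => norm_ne_zero_iff.2 (h0 j)
    have h1 : M u = (∏ j, ‖u j‖) * M fun j => ‖u j‖⁻¹ • u j := by
      rw [← smul_eq_mul, ← M.map_smul_univ]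
      congr 1
      ext j
      rw [smul_inv_smul₀ (hn j)]
    rw [h1, abs_mul, abs_of_nonneg (Finset.prod_nonneg fun _ _ => norm_nonneg _), mul_comm]
    refine mul_le_mul_of_nonneg_right (hC _ fun j => ?_)
      (Finset.prod_nonneg fun _ _ => norm_nonneg _)
    rw [norm_smul, norm_inv, norm_norm, inv_mul_cancel₀ (hn j)]

/-- Polarization in the two slots gives `4 B(u i, u j) = B(s, s) - B(d, d)` with `s` the sum and `d`
the difference. As `|B(d, d)| ≤ C ‖d‖²` and `‖s‖² + ‖d‖² = 4`, it follows that `|B(s, s)| ≥ C ‖s‖²`.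
-/
theorem abs_multilinear_midpoint [DecidableEq ι] (M : MultilinearMap ℝ (fun _ : ι => E) ℝ)
    (hM : ∀ (σ : Equiv.Perm ι) (u : ι → E), M (u ∘ σ) = M u) {C : ℝ}
    (hC : ∀ u : ι → E, (∀ j, ‖u j‖ = 1) → |M u| ≤ C) {u : ι → E} (hu : ∀ j, ‖u j‖ = 1)
    (huC : |M u| = C) {i j : ι} (hij : i ≠ j) (hs : u i + u j ≠ 0) :
    C ≤ |M (Function.update (Function.update u i (‖u i + u j‖⁻¹ • (u i + u j))) j
      (‖u i + u j‖⁻¹ • (u i + u j)))| := by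
  set B : E → E → ℝ := fun x y => M (Function.update (Function.update u i x) j y) with hB
  have addr : ∀ x y y', B x (y + y') = B x y + B x y' := fun x y y' => M.map_update_add _ _ _ _
  have smulr : ∀ (c : ℝ) x y, B x (c • y) = c * B x y := fun c x y => M.map_update_smul _ _ _ _
  have symm : ∀ x y, B x y = B y x := by
    intro x y
    simp only [hB]
    rw [← hM (Equiv.swap i j)]
    congr 1
    ext l
    by_cases hi : l = i
    · subst hi; simp [hij]
    · by_cases hj : l = j
      · subst hj; simp [hij]
      · simp [Equiv.swap_apply_of_ne_of_ne hi hj, hi, hj]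
  have addl : ∀ x x' y, B (x + x') y = B x y + B x' y := fun x x' y => by
    rw [symm, addr, symm y, symm y]
  have smull : ∀ (c : ℝ) x y, B (c • x) y = c * B x y := fun c x y => by
    rw [symm, smulr, symm y]
  have bound : ∀ x, |B x x| ≤ C * ‖x‖ ^ 2 := by
    intro x
    refine (abs_multilinear_le_mul_prod_norm M hC _).trans_eq ?_
    congr 1
    rw [← Finset.mul_prod_erase _ _ (Finset.mem_univ i),
      ← Finset.mul_prod_erase _ _ (Finset.mem_erase.2 ⟨hij.symm, Finset.mem_univ j⟩),
      Finset.prod_eq_one]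
    · simp [hij, pow_two]
    · intro l hl
      have h1 := Finset.ne_of_mem_erase hl
      have h2 := Finset.ne_of_mem_erase (Finset.mem_of_mem_erase hl)
      simp [h1, h2, hu]
  set s := u i + u j with hsdef
  set d := u i - u j with hddef
  have hpar : ‖s‖ ^ 2 + ‖d‖ ^ 2 = 4 := by
    have := parallelogram_law_with_norm ℝ (u i) (u j)
    rw [hu, hu] at this
    nlinarith
  have hBu : B (u i) (u j) = M u := by simp [hB]
  have hpol : 4 * B (u i) (u j) = B s s - B d d := by
    have hd' : d = u i + (-1 : ℝ) • u j := by rw [hddef, neg_one_smul, sub_eq_add_neg]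
    rw [hd', hsdef]
    simp only [addl, addr, smull, smulr]
    rw [symm (u j) (u i)]
    ring
  have h4 : 4 * C ≤ |B s s| + C * ‖d‖ ^ 2 := by
    calc 4 * C = |4 * B (u i) (u j)| := by rw [abs_mul, hBu, huC]; norm_num
      _ ≤ |B s s| + |B d d| := by rw [hpol]; exact abs_sub _ _
      _ ≤ _ := by gcongr; exact bound d
  have hspos : 0 < ‖s‖ := norm_pos_iff.2 hs
  change C ≤ |B (‖s‖⁻¹ • s) (‖s‖⁻¹ • s)|
  rw [smull, smulr, ← mul_assoc, abs_mul, abs_of_pos (by positivity)]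
  have h5 : C * ‖s‖ ^ 2 ≤ |B s s| := by
    have h6 : C * 4 = C * ‖s‖ ^ 2 + C * ‖d‖ ^ 2 := by rw [← mul_add, hpar]
    linarith
  calc C = (‖s‖⁻¹ * ‖s‖⁻¹) * (C * ‖s‖ ^ 2) := by field_simp
    _ ≤ _ := mul_le_mul_of_nonneg_left h5 (by positivity)

/-- The replacement adds `(2 / ‖s‖ - 1) s` to the total sum, where `s = u i + u j`. The factor is
positive as `‖s‖ < 2` for distinct unit vectors, and `s` has positive inner product with the sum. -/
theorem norm_lt_norm_sum_update_update [DecidableEq ι] {u : ι → E} (hu : ∀ j, ‖u j‖ = 1)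
    {i j : ι} (hij : u i ≠ u j) (hS : 0 < inner ℝ (∑ l, u l) (u i + u j)) :
    ‖∑ l, u l‖ < ‖∑ l, Function.update (Function.update u i (‖u i + u j‖⁻¹ • (u i + u j))) j
      (‖u i + u j‖⁻¹ • (u i + u j)) l‖ := by
  have hne : i ≠ j := fun h => hij (by rw [h])
  set s := u i + u j with hsdef
  set S := ∑ l, u l with hSdef
  set z := ‖s‖⁻¹ • s with hz
  have hspos : 0 < ‖s‖ := by
    refine norm_pos_iff.2 fun h => ?_
    rw [h, inner_zero_right] at hS
    exact lt_irrefl _ hS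
  have hs2 : ‖s‖ < 2 := by
    have h1 := parallelogram_law_with_norm ℝ (u i) (u j)
    rw [hu, hu] at h1
    have h2 : 0 < ‖u i - u j‖ := norm_pos_iff.2 (sub_ne_zero.2 hij)
    nlinarith
  have hsum : ∑ l, Function.update (Function.update u i z) j z l = S + (2 * ‖s‖⁻¹ - 1) • s := by
    rw [← Finset.add_sum_erase _ _ (Finset.mem_univ i),
      ← Finset.add_sum_erase _ _ (Finset.mem_erase.2 ⟨hne.symm, Finset.mem_univ j⟩), hSdef,
      ← Finset.add_sum_erase _ u (Finset.mem_univ i),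
      ← Finset.add_sum_erase _ u (Finset.mem_erase.2 ⟨hne.symm, Finset.mem_univ j⟩)]
    have e : ∑ l ∈ (Finset.univ.erase i).erase j, Function.update (Function.update u i z) j z l =
        ∑ l ∈ (Finset.univ.erase i).erase j, u l := by
      refine Finset.sum_congr rfl fun l hl => ?_
      rw [Function.update_of_ne (Finset.ne_of_mem_erase hl),
        Function.update_of_ne (Finset.ne_of_mem_erase (Finset.mem_of_mem_erase hl))]
    rw [e, Function.update_self, Function.update_of_ne hne, Function.update_self, hz, hsdef]
    module
  rw [hsum]
  set c := 2 * ‖s‖⁻¹ - 1 with hc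
  have hcpos : 0 < c := by
    have : 1 < 2 * ‖s‖⁻¹ := by
      rw [← div_eq_mul_inv, one_lt_div hspos]
      exact hs2
    linarith
  refine lt_of_pow_lt_pow_left₀ 2 (norm_nonneg _) ?_
  rw [norm_add_sq_real, inner_smul_right]
  have := mul_pos hcpos hS
  have := sq_nonneg ‖c • s‖
  linarith

/-- Banach's theorem: a symmetric multilinear form attains its maximum modulus over products of
unit balls on the diagonal. -/
theorem exists_abs_multilinear_le_diagonal [Nonempty ι] [FiniteDimensional ℝ E] [Nontrivial E]
    (M : MultilinearMap ℝ (fun _ : ι => E) ℝ) (hcont : Continuous M)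
    (hM : ∀ (σ : Equiv.Perm ι) (u : ι → E), M (u ∘ σ) = M u) :
    ∃ v : E, ‖v‖ = 1 ∧ ∀ u : ι → E, (∀ j, ‖u j‖ ≤ 1) → |M u| ≤ |M fun _ => v| := by
  classical
  have hScomp : IsCompact (Set.univ.pi fun _ : ι => Metric.sphere (0 : E) 1) :=
    isCompact_univ_pi fun _ => isCompact_sphere _ _
  have hSmem : ∀ u : ι → E, u ∈ (Set.univ.pi fun _ : ι => Metric.sphere (0 : E) 1) ↔
      ∀ j, ‖u j‖ = 1 := fun u => by simp [Set.mem_pi]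
  obtain ⟨x, hx⟩ := exists_norm_eq E zero_le_one
  obtain ⟨u₀, hu₀, hmax⟩ := hScomp.exists_isMaxOn ⟨fun _ => x, (hSmem _).2 fun _ => hx⟩
    hcont.abs.continuousOn
  have hC : ∀ u : ι → E, (∀ j, ‖u j‖ = 1) → |M u| ≤ |M u₀| := fun u hu =>
    hmax ((hSmem u).2 hu)
  -- Among all maximizers of `|M|`, choose one with the longest vector sum; it will turn out to be
  -- diagonal.
  obtain ⟨u, ⟨hu, huC⟩, humax⟩ := (hScomp.inter_right
    (isClosed_eq hcont.abs continuous_const : IsClosed {u : ι → E | |M u| = |M u₀|})).exists_isMaxOn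
    ⟨u₀, hu₀, rfl⟩ (f := fun u : ι → E => ‖∑ j, u j‖) (by fun_prop)
  rw [hSmem] at hu
  have huC : |M u| = |M u₀| := huC
  have hmaxsum : ∀ w : ι → E, (∀ j, ‖w j‖ = 1) → |M w| = |M u₀| →
      ‖∑ j, w j‖ ≤ ‖∑ j, u j‖ := fun w hw hwC => humax ⟨(hSmem w).2 hw, hwC⟩
  -- Flipping the sign of `u i` keeps `|M|`, so with `S` the vector sum `‖S - 2 u i‖ ≤ ‖S‖`.
  have hinner : ∀ i, 1 ≤ inner ℝ (∑ l, u l) (u i) := by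
    intro i
    have h1 := hmaxsum (Function.update u i (-u i)) (fun j => by
      by_cases h : j = i
      · subst h; simp [hu]
      · simp [h, hu]) (by
      rw [← neg_one_smul ℝ (u i), M.map_update_smul, Function.update_eq_self, smul_eq_mul, abs_mul]
      simpa using huC)
    have h2 : ∑ j, Function.update u i (-u i) j = ∑ j, u j - (2 : ℝ) • u i := by
      rw [← Finset.add_sum_erase _ _ (Finset.mem_univ i),
        ← Finset.add_sum_erase _ u (Finset.mem_univ i), Function.update_self,
        Finset.sum_congr rfl fun l hl => Function.update_of_ne (Finset.ne_of_mem_erase hl) _ _]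
      module
    rw [h2] at h1
    have h3 := pow_le_pow_left₀ (norm_nonneg _) h1 2
    rw [norm_sub_sq_real, inner_smul_right, norm_smul, hu] at h3
    norm_num at h3
    linarith
  have hall : ∀ i j, u i = u j := by
    intro i j
    by_contra hij
    have hne : i ≠ j := fun h => hij (by rw [h])
    have hS : 0 < inner ℝ (∑ l, u l) (u i + u j) := by
      rw [inner_add_right]
      linarith [hinner i, hinner j]
    have hs : u i + u j ≠ 0 := fun h => by
      rw [h, inner_zero_right] at hS
      exact lt_irrefl _ hS
    have hz : ‖‖u i + u j‖⁻¹ • (u i + u j)‖ = 1 := by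
      rw [norm_smul, norm_inv, norm_norm, inv_mul_cancel₀ (norm_ne_zero_iff.2 hs)]
    have hw : ∀ l, ‖Function.update (Function.update u i (‖u i + u j‖⁻¹ • (u i + u j))) j
        (‖u i + u j‖⁻¹ • (u i + u j)) l‖ = 1 := by
      intro l
      by_cases hl : l = j
      · subst hl; simpa using hz
      · by_cases hl' : l = i
        · subst hl'; simpa [hl] using hz
        · simp [hl, hl', hu]
    exact absurd (hmaxsum _ hw (le_antisymm (hC _ hw)
      (abs_multilinear_midpoint M hM hC hu huC hne hs)))
      (not_le.2 (norm_lt_norm_sum_update_update hu hij hS))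
  obtain ⟨i⟩ := ‹Nonempty ι›
  refine ⟨u i, hu i, fun w hw => ?_⟩
  have hui : (fun _ => u i) = u := funext fun j => hall i j
  rw [hui, huC]
  refine (abs_multilinear_le_mul_prod_norm M hC w).trans ?_
  exact mul_le_of_le_one_right (abs_nonneg _)
    (Finset.prod_le_one (fun _ _ => norm_nonneg _) fun j _ => hw j)

end Banach

/-! ### Operator norm of symmetric tensors. -/

section TensorForm

variable {k n : ℕ}

/-- The multilinear form `u ↦ ⟨X, u₁ ⊗ ⋯ ⊗ uₖ⟩`. -/
noncomputable def tensorForm (X : Tensor k n) :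
    MultilinearMap ℝ (fun _ : Fin k => EuclideanSpace ℝ (Fin n)) ℝ :=
  ∑ i : Fin k → Fin n, X i • (MultilinearMap.mkPiAlgebra ℝ (Fin k) ℝ).compLinearMap
    fun j => (EuclideanSpace.proj (i j) : EuclideanSpace ℝ (Fin n) →L[ℝ] ℝ).toLinearMap

theorem tensorForm_apply (X : Tensor k n) (u : Fin k → EuclideanSpace ℝ (Fin n)) :
    tensorForm X u = tinner X (outer u) := by
  simp [tensorForm, tinner, outer]

theorem continuous_tinner_outer (X : Tensor k n) :
    Continuous fun u : Fin k → EuclideanSpace ℝ (Fin n) => tinner X (outer u) := by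
  unfold tinner outer
  fun_prop

theorem tinner_permute_outer (X : Tensor k n) (σ : Equiv.Perm (Fin k))
    (u : Fin k → EuclideanSpace ℝ (Fin n)) :
    tinner (permute σ X) (outer u) = tinner X (outer (u ∘ σ)) := by
  unfold tinner outer permute
  refine Fintype.sum_equiv (Equiv.arrowCongr σ.symm (Equiv.refl _)) _ _ fun i => ?_
  congr 1
  exact (Equiv.prod_comp σ fun j => u j (i j)).symm

/-- The operator norm of a symmetric tensor is a maximum over the diagonal, up to sign. -/
theorem isLUB_opNorm_of_symmetric (hk : 1 ≤ k) (hn : 1 ≤ n) (X : Tensor k n)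
    (hX : ∀ σ, permute σ X = X) :
    IsLUB (Set.range fun p : ℤˣ × Metric.sphere (0 : EuclideanSpace ℝ (Fin n)) 1 =>
      ((p.1 : ℤ) : ℝ) * tinner X (outerPow k (p.2 : EuclideanSpace ℝ (Fin n)))) (opNorm X) := by
  have : Nonempty (Fin k) := ⟨⟨0, hk⟩⟩
  have : Nonempty (Fin n) := ⟨⟨0, hn⟩⟩
  have hform : ⇑(tensorForm X) = fun u => tinner X (outer u) := funext (tensorForm_apply X)
  obtain ⟨v, hv, hmax⟩ := exists_abs_multilinear_le_diagonal (tensorForm X)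
    (by rw [hform]; exact continuous_tinner_outer X) fun σ u => by
      rw [tensorForm_apply, tensorForm_apply, ← tinner_permute_outer, hX]
  obtain ⟨⟨w, hw, hwX⟩, hub⟩ := isGreatest_opNorm X
  refine ⟨?_, fun c hc => ?_⟩
  · rintro _ ⟨⟨ε, x, hx⟩, rfl⟩
    rw [mem_sphere_zero_iff_norm] at hx
    rcases Int.units_eq_one_or ε with rfl | rfl
    · exact hub ⟨fun _ => x, fun _ => hx.le, by simp [outerPow]⟩
    -- A negative sign is absorbed by negating a single slot of the product.
    · let j : Fin k := ⟨0, hk⟩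
      refine hub ⟨Function.update (fun _ => x) j (-x), fun l => ?_, ?_⟩
      · by_cases h : l = j
        · subst h; simp [hx]
        · simp [h, hx]
      · rw [← tensorForm_apply, ← neg_one_smul ℝ x, MultilinearMap.map_update_smul]
        simp [tensorForm_apply, outerPow, Function.update_eq_self]
  · have h1 := hmax w hw
    rw [tensorForm_apply, ← hwX, tensorForm_apply] at h1
    refine ((le_abs_self _).trans h1).trans ?_
    rcases abs_choice (tinner X (outer fun _ => v)) with h | h
    · rw [h]
      exact hc ⟨(1, ⟨v, by simpa using hv⟩), by simp [outerPow]⟩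
    · rw [h]
      exact hc ⟨(-1, ⟨v, by simpa using hv⟩), by simp [outerPow]⟩

end TensorForm

/-! ### The spiked tensor on the diagonal. -/

section Spiked

variable {k n : ℕ}

theorem permute_outerPow (σ : Equiv.Perm (Fin k)) (v : EuclideanSpace ℝ (Fin n)) :
    permute σ (outerPow k v) = outerPow k v := by
  ext i
  exact Equiv.prod_comp σ fun j => v (i j)

theorem permute_symNoise (σ : Equiv.Perm (Fin k)) (G : Tensor k n) :
    permute σ (symNoise G) = symNoise G := by
  ext i
  simp only [symNoise, permute, Pi.smul_apply, Finset.sum_apply]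
  congr 1
  exact Fintype.sum_equiv (Equiv.mulLeft σ) _ _ fun π => rfl

theorem permute_spiked (β : ℝ) (v₀ : EuclideanSpace ℝ (Fin n)) (G : Tensor k n)
    (σ : Equiv.Perm (Fin k)) : permute σ (spiked β v₀ G) = spiked β v₀ G := by
  calc permute σ (spiked β v₀ G)
      = β • permute σ (outerPow k v₀) + permute σ (symNoise G) := rfl
    _ = _ := by rw [permute_outerPow, permute_symNoise, spiked]

theorem outerPow_dotProduct_outerPow (v w : EuclideanSpace ℝ (Fin n)) :
    outerPow k v ⬝ᵥ outerPow k w = inner ℝ v w ^ k := by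
  have h : inner ℝ v w = ∑ l, v l * w l := by
    rw [PiLp.inner_apply]
    exact Finset.sum_congr rfl fun l _ => by simp [mul_comm]
  have h2 := Finset.prod_univ_sum (fun _ : Fin k => (Finset.univ : Finset (Fin n)))
    fun _ l => v l * w l
  rw [Finset.prod_const, Finset.card_univ, Fintype.card_fin, Fintype.piFinset_univ] at h2
  rw [h, h2]
  simp only [dotProduct, outerPow, outer, Finset.prod_mul_distrib]

theorem tinner_eq_dotProduct (X Y : Tensor k n) : tinner X Y = X ⬝ᵥ Y := rfl

/-- All `k!` permutations of `G` pair equally with `v^{⊗k}`, so the symmetrization disappears. -/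
theorem tinner_spiked_outerPow (β : ℝ) (v₀ v : EuclideanSpace ℝ (Fin n)) (G : Tensor k n) :
    tinner (spiked β v₀ G) (outerPow k v) =
      β * inner ℝ v₀ v ^ k + √((k : ℝ) / n) * (outerPow k v ⬝ᵥ G) := by
  have hk : (k.factorial : ℝ) ≠ 0 := by exact_mod_cast k.factorial_ne_zero
  have h : ∀ π : Equiv.Perm (Fin k),
      permute π G ⬝ᵥ outerPow k v = outerPow k v ⬝ᵥ G := fun π => by
    rw [dotProduct_comm _ G, ← tinner_eq_dotProduct, ← tinner_eq_dotProduct, outerPow,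
      tinner_permute_outer]
    rfl
  rw [tinner_eq_dotProduct, spiked, symNoise, add_dotProduct, smul_dotProduct, smul_dotProduct,
    outerPow_dotProduct_outerPow, sum_dotProduct]
  simp only [h, Finset.sum_const, Finset.card_univ, Fintype.card_perm, Fintype.card_fin,
    smul_eq_mul, nsmul_eq_mul]
  field_simp

end Spiked

/-- Allows the supremum over the sphere to be taken along a sequence, as the smooth maximum
requires. -/
theorem isLUB_range_comp_of_dense {ι κ : Type*} [TopologicalSpace ι] {f : ι → ℝ}
    (hf : Continuous f) {d : κ → ι} (hd : DenseRange d) {x : ℝ} (hx : IsLUB (Set.range f) x) :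
    IsLUB (Set.range fun i => f (d i)) x := by
  refine ⟨?_, fun c hc => hx.2 ?_⟩
  · rintro _ ⟨i, rfl⟩
    exact hx.1 ⟨d i, rfl⟩
  · rintro _ ⟨p, rfl⟩
    exact hd.induction_on (p := fun p => f p ≤ c) p (isClosed_le hf continuous_const)
      fun i => hc ⟨i, rfl⟩

/-! ### The Gaussian process on the signed sphere and its comparison process. -/

section Parametrization

variable (k n : ℕ)

/-- Signs and unit vectors. -/
abbrev SignedSphere (n : ℕ) : Type := ℤˣ × Metric.sphere (0 : EuclideanSpace ℝ (Fin n)) 1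

/-- The sign of a pair. -/
def SignedSphere.sign {n : ℕ} (p : SignedSphere n) : ℝ := ((p.1 : ℤ) : ℝ)

/-- The unit vector of a pair. -/
def SignedSphere.vec {n : ℕ} (p : SignedSphere n) : EuclideanSpace ℝ (Fin n) := p.2

variable {k n}

theorem SignedSphere.norm_vec (p : SignedSphere n) : ‖p.vec‖ = 1 :=
  mem_sphere_zero_iff_norm.1 p.2.2

theorem SignedSphere.sign_eq (p : SignedSphere n) : p.sign = 1 ∨ p.sign = -1 := by
  rcases Int.units_eq_one_or p.1 with h | h <;> simp [SignedSphere.sign, h]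

theorem SignedSphere.abs_sign (p : SignedSphere n) : |p.sign| = 1 := by
  rcases p.sign_eq with h | h <;> simp [h]

theorem SignedSphere.abs_inner_le (p q : SignedSphere n) : |inner ℝ p.vec q.vec| ≤ 1 := by
  simpa [p.norm_vec, q.norm_vec] using abs_real_inner_le_norm p.vec q.vec

theorem SignedSphere.nonempty (hn : 1 ≤ n) : Nonempty (SignedSphere n) := by
  have : Nonempty (Fin n) := ⟨⟨0, hn⟩⟩
  obtain ⟨x, hx⟩ := exists_norm_eq (EuclideanSpace ℝ (Fin n)) zero_le_one
  exact ⟨(1, ⟨x, by simpa using hx⟩)⟩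

/-- The mean of the process indexed by signed unit vectors. -/
noncomputable def processMean (k : ℕ) (β : ℝ) (v₀ : EuclideanSpace ℝ (Fin n))
    (p : SignedSphere n) : ℝ := p.sign * (β * inner ℝ v₀ p.vec ^ k)

/-- The Gaussian coefficients of the process indexed by signed unit vectors. -/
noncomputable def processCoeff (k : ℕ) (p : SignedSphere n) : Tensor k n :=
  (p.sign * √((k : ℝ) / n)) • outerPow k p.vec

/-- The coefficients of the comparison process. -/
noncomputable def comparisonCoeff (k : ℕ) (p : SignedSphere n) : Fin n ⊕ Unit → ℝ :=
  Sum.elim (((k : ℝ) / √n) • (p.vec : Fin n → ℝ)) fun _ => p.sign * √((k : ℝ) / n)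

theorem isLUB_opNorm_spiked (hk : 1 ≤ k) (hn : 1 ≤ n) (β : ℝ) (v₀ : EuclideanSpace ℝ (Fin n))
    {d : ℕ → SignedSphere n} (hd : DenseRange d) (G : Tensor k n) :
    IsLUB (Set.range fun i => processMean k β v₀ (d i) + processCoeff k (d i) ⬝ᵥ G)
      (opNorm (spiked β v₀ G)) := by
  refine isLUB_range_comp_of_dense (f := fun p => processMean k β v₀ p + processCoeff k p ⬝ᵥ G)
    ?_ hd ?_
  · unfold processMean processCoeff SignedSphere.sign SignedSphere.vec outerPow outer dotProduct
    have h1 : Continuous fun p : SignedSphere n => ((p.1 : ℤ) : ℝ) :=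
      (continuous_of_discreteTopology (f := fun u : ℤˣ => ((u : ℤ) : ℝ))).comp continuous_fst
    have h2 : Continuous fun p : SignedSphere n => (p.2 : EuclideanSpace ℝ (Fin n)) := by fun_prop
    simp only [Pi.smul_apply, smul_eq_mul]
    fun_prop
  · convert isLUB_opNorm_of_symmetric hk hn (spiked β v₀ G) (permute_spiked β v₀ G) using 3 with p
    rw [tinner_spiked_outerPow, processMean, processCoeff, smul_dotProduct, smul_eq_mul]
    simp only [SignedSphere.sign, SignedSphere.vec]
    ring

theorem processCoeff_dotProduct (p q : SignedSphere n) :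
    processCoeff k p ⬝ᵥ processCoeff k q =
      p.sign * q.sign * ((k : ℝ) / n) * inner ℝ p.vec q.vec ^ k := by
  rw [processCoeff, processCoeff, smul_dotProduct, dotProduct_smul, outerPow_dotProduct_outerPow,
    smul_eq_mul, smul_eq_mul]
  have : √((k : ℝ) / n) * √((k : ℝ) / n) = (k : ℝ) / n := Real.mul_self_sqrt (by positivity)
  linear_combination (p.sign * q.sign * inner ℝ p.vec q.vec ^ k) * this

theorem abs_processCoeff_dotProduct_le (p q : SignedSphere n) :
    |processCoeff k p ⬝ᵥ processCoeff k q| ≤ (k : ℝ) / n := by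
  rw [processCoeff_dotProduct, abs_mul, abs_mul, abs_mul, p.abs_sign, q.abs_sign, abs_pow,
    abs_of_nonneg (by positivity : (0 : ℝ) ≤ (k : ℝ) / n), one_mul, one_mul]
  exact mul_le_of_le_one_right (by positivity) (pow_le_one₀ (abs_nonneg _) (p.abs_inner_le q))

theorem inner_eq_dotProduct (v w : EuclideanSpace ℝ (Fin n)) :
    inner ℝ v w = (v : Fin n → ℝ) ⬝ᵥ (w : Fin n → ℝ) := by
  rw [PiLp.inner_apply]
  exact Finset.sum_congr rfl fun l _ => by simp [mul_comm]

theorem comparisonCoeff_dotProduct (p q : SignedSphere n) :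
    comparisonCoeff k p ⬝ᵥ comparisonCoeff k q =
      (k : ℝ) ^ 2 / n * inner ℝ p.vec q.vec + p.sign * q.sign * ((k : ℝ) / n) := by
  have h1 : √((k : ℝ) / n) * √((k : ℝ) / n) = (k : ℝ) / n := Real.mul_self_sqrt (by positivity)
  have h2 : (k : ℝ) / √n * (k / √n) = (k : ℝ) ^ 2 / n := by
    rw [div_mul_div_comm, Real.mul_self_sqrt (by positivity), pow_two]
  rw [comparisonCoeff, comparisonCoeff, sumElim_dotProduct_sumElim, smul_dotProduct,
    dotProduct_smul, inner_eq_dotProduct, smul_eq_mul, smul_eq_mul]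
  simp only [dotProduct, Finset.univ_unique, Finset.sum_singleton]
  rw [← h2]
  linear_combination (p.sign * q.sign) * h1

theorem processCoeff_sub_le_comparisonCoeff_sub (p q : SignedSphere n) :
    (processCoeff k p - processCoeff k q) ⬝ᵥ (processCoeff k p - processCoeff k q) ≤
      (comparisonCoeff k p - comparisonCoeff k q) ⬝ᵥ
        (comparisonCoeff k p - comparisonCoeff k q) := by
  simp only [sub_dotProduct, dotProduct_sub, processCoeff_dotProduct, comparisonCoeff_dotProduct]
  simp only [real_inner_self_eq_norm_sq, SignedSphere.norm_vec, real_inner_comm p.vec q.vec,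
    one_pow, mul_one, mul_comm q.sign p.sign]
  set ρ := inner ℝ p.vec q.vec
  have hρ := abs_le.1 (p.abs_inner_le q)
  have hc : (0 : ℝ) ≤ (k : ℝ) / n := by positivity
  have hk : (k : ℝ) ^ 2 / n = (k : ℝ) / n * k := by ring
  rw [hk]
  have hbern : 1 + k * (ρ - 1) ≤ ρ ^ k := by
    simpa using one_add_mul_le_pow (a := ρ - 1) (by linarith) k
  have hpow : ρ ^ k ≤ 1 := (le_abs_self _).trans
    (by rw [abs_pow]; exact pow_le_one₀ (abs_nonneg _) (p.abs_inner_le q))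
  have hkρ : 0 ≤ (k : ℝ) * (1 - ρ) := mul_nonneg (by positivity) (by linarith)
  have h1 := mul_le_mul_of_nonneg_left hbern hc
  have h2 := mul_le_mul_of_nonneg_left hpow hc
  have h3 := mul_nonneg hc hkρ
  -- Equal signs need Bernoulli's inequality. For opposite signs the scalar Gaussian contributes
  -- `4k/n`, which already covers `2(k/n)(1 + ρ ^ k)`.
  rcases p.sign_eq with hp | hp <;> rcases q.sign_eq with hq | hq <;> rw [hp, hq] <;> nlinarith

end Parametrization

/-! ### Second moments. -/

section Moments

theorem integrable_pow_gaussianReal (j : ℕ) :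
    Integrable (fun x : ℝ => x ^ j) (gaussianReal 0 1) :=
  integrable_pow_of_integrable_exp_mul (X := fun x : ℝ => x) one_ne_zero
    (integrable_exp_mul_gaussianReal 1) (integrable_exp_mul_gaussianReal (-1)) j

theorem integral_sq_gaussianReal : ∫ x, x ^ 2 ∂(gaussianReal 0 1) = 1 := by
  have h := integral_mul_gaussianReal (u := fun x => x) (u' := fun _ => 1)
    (fun x => hasDerivAt_id x) (by simpa using integrable_pow_gaussianReal 1)
    (integrable_const _) (by simpa [pow_two] using integrable_pow_gaussianReal 2)
  simpa [pow_two] using h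

variable {κ : Type*} [Fintype κ]

theorem integral_sq_sum_stdGauss {f : κ → ℝ → ℝ} (hf : ∀ l, MemLp (f l) 2 (gaussianReal 0 1))
    (h0 : ∀ l, ∫ x, f l x ∂(gaussianReal 0 1) = 0) :
    ∫ g, (∑ l, f l (g l)) ^ 2 ∂(stdGauss κ) = ∑ l, ∫ x, f l x ^ 2 ∂(gaussianReal 0 1) := by
  have hmp := fun l => measurePreserving_eval (fun _ : κ => gaussianReal 0 1) l
  have hL := fun l => (hf l).comp_measurePreserving (hmp l)
  have hi : ∀ l, Integrable (fun g : κ → ℝ => f l (g l)) (stdGauss κ) := fun l =>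
    (hL l).integrable one_le_two
  have hm : ∀ l, ∫ g, f l (g l) ∂(stdGauss κ) = 0 := by
    intro l
    rw [← h0 l, ← (hmp l).map_eq, integral_map (hmp l).measurable.aemeasurable
      (by rw [(hmp l).map_eq]; exact (hf l).1)]
  have hv := variance_sum_pi hf
  have e : (∑ l, fun g : κ → ℝ => f l (g l)) = fun g => ∑ l, f l (g l) := by
    ext g; simp
  rw [e, variance_of_integral_eq_zero] at hv
  · rw [hv]
    exact Finset.sum_congr rfl fun l _ =>
      variance_of_integral_eq_zero (hf l).1.aemeasurable (h0 l)
  · exact (integrable_finsetSum _ fun l _ => hi l).aestronglyMeasurable.aemeasurable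
  · rw [integral_finsetSum _ fun l _ => hi l]
    simp [hm]

theorem integral_sq_dotProduct_stdGauss (w : κ → ℝ) :
    ∫ g, (w ⬝ᵥ g) ^ 2 ∂(stdGauss κ) = w ⬝ᵥ w := by
  unfold dotProduct
  rw [integral_sq_sum_stdGauss (f := fun l x => w l * x)]
  · refine Finset.sum_congr rfl fun l _ => ?_
    simp only [mul_pow, integral_const_mul, integral_sq_gaussianReal]
    ring
  · intro l
    exact (memLp_id_gaussianReal 2).const_mul (w l)
  · intro l
    rw [integral_const_mul, integral_id_gaussianReal, mul_zero]

/-- The variance of the square of a standard Gaussian. -/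
noncomputable def sqVariance : ℝ := ∫ x, (x ^ 2 - 1) ^ 2 ∂(gaussianReal 0 1)

theorem integral_sq_sum_sq_sub_one (κ : Type*) [Fintype κ] :
    ∫ g, (∑ l, (g l ^ 2 - 1)) ^ 2 ∂(stdGauss κ) = Fintype.card κ * sqVariance := by
  rw [integral_sq_sum_stdGauss (f := fun _ x => x ^ 2 - 1)]
  · simp [sqVariance]
  · intro _
    rw [memLp_two_iff_integrable_sq (by fun_prop)]
    refine (((integrable_pow_gaussianReal 4).sub
      ((integrable_pow_gaussianReal 2).const_mul 2)).add (integrable_const 1)).congr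
      (Filter.Eventually.of_forall fun x => ?_)
    simp only [Pi.add_apply, Pi.sub_apply]
    ring
  · intro _
    rw [integral_sub (integrable_pow_gaussianReal 2) (integrable_const 1),
      integral_sq_gaussianReal]
    simp

end Moments

/-- Split `v` into its component along `v₀` and the orthogonal remainder, whose norm is `√(1 - ⟨v₀,
v⟩²)`. -/
theorem inner_le_abs_inner_add {E : Type*} [NormedAddCommGroup E] [InnerProductSpace ℝ E]
    {v₀ v : E} (hv₀ : ‖v₀‖ = 1) (hv : ‖v‖ = 1) (g : E) :
    inner ℝ v g ≤ |inner ℝ v₀ g| + √(1 - inner ℝ v₀ v ^ 2) * ‖g‖ := by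
  set t := inner ℝ v₀ v with ht
  have habs : |t| ≤ 1 := by simpa [hv₀, hv] using abs_real_inner_le_norm v₀ v
  have hw : ‖v - t • v₀‖ = √(1 - t ^ 2) := by
    rw [eq_comm, Real.sqrt_eq_iff_mul_self_eq (by nlinarith [abs_le.1 habs]) (norm_nonneg _),
      ← pow_two, norm_sub_sq_real, inner_smul_right, real_inner_comm, ← ht, norm_smul, hv, hv₀,
      Real.norm_eq_abs, mul_one, sq_abs]
    ring
  have hsplit : inner ℝ v g = t * inner ℝ v₀ g + inner ℝ (v - t • v₀) g := by
    rw [inner_sub_left, inner_smul_left]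
    simp
  rw [hsplit, ← hw]
  refine add_le_add ?_ (real_inner_le_norm _ _)
  calc t * inner ℝ v₀ g ≤ |t| * |inner ℝ v₀ g| := by rw [← abs_mul]; exact le_abs_self _
    _ ≤ _ := mul_le_of_le_one_left (abs_nonneg _) habs

/-! ### The bound on the mean and the variational formula. -/

section Expectation

variable {k n : ℕ}

/-- An explicit upper bound for the comparison process. -/
noncomputable def comparisonBound (k : ℕ) {n : ℕ} (M : ℝ) (v₀ : EuclideanSpace ℝ (Fin n))
    (g : Fin n ⊕ Unit → ℝ) : ℝ :=
  M + k * (√n * ((∑ l, ((g ∘ Sum.inl) l ^ 2 - 1)) / n) ^ 2 + (√n)⁻¹) +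
    k / √n * (1 + ((v₀ : Fin n → ℝ) ⬝ᵥ (g ∘ Sum.inl)) ^ 2) +
    √((k : ℝ) / n) * (1 + ((fun _ => 1) ⬝ᵥ (g ∘ Sum.inr)) ^ 2)

theorem comparison_le_comparisonBound (hn : 1 ≤ n) {β M : ℝ} (hβ : 0 ≤ β)
    (hM : ∀ t ∈ Set.Icc (0 : ℝ) 1, β * t ^ k + k * √(1 - t ^ 2) ≤ M)
    {v₀ : EuclideanSpace ℝ (Fin n)} (hv₀ : ‖v₀‖ = 1) (p : SignedSphere n)
    (g : Fin n ⊕ Unit → ℝ) :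
    processMean k β v₀ p + comparisonCoeff k p ⬝ᵥ g ≤ comparisonBound k M v₀ g := by
  have hn0 : (0 : ℝ) < n := by exact_mod_cast hn
  have hr : 0 < √(n : ℝ) := Real.sqrt_pos.2 hn0
  have hr2 : √(n : ℝ) * √n = n := Real.mul_self_sqrt hn0.le
  set x : EuclideanSpace ℝ (Fin n) := WithLp.toLp 2 (g ∘ Sum.inl) with hx
  set ξ : ℝ := (fun _ => 1) ⬝ᵥ (g ∘ Sum.inr) with hξ
  set S : ℝ := ∑ l, ((g ∘ Sum.inl) l ^ 2 - 1) with hS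
  set t := inner ℝ v₀ p.vec with ht
  have habs : |t| ≤ 1 := by simpa [hv₀, p.norm_vec] using abs_real_inner_le_norm v₀ p.vec
  have hnorm : ‖x‖ ^ 2 = S + n := by
    rw [EuclideanSpace.real_norm_sq_eq, hS, Finset.sum_sub_distrib]
    simp [hx]
  have hdot : comparisonCoeff k p ⬝ᵥ g =
      k / √n * inner ℝ p.vec x + p.sign * √((k : ℝ) / n) * ξ := by
    have hg : g = Sum.elim (g ∘ Sum.inl) (g ∘ Sum.inr) := (Sum.elim_comp_inl_inr g).symm
    conv_lhs => rw [hg]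
    rw [comparisonCoeff, sumElim_dotProduct_sumElim, smul_dotProduct, inner_eq_dotProduct,
      smul_eq_mul, hξ]
    simp [dotProduct, hx]
  have hv0x : inner ℝ v₀ x = (v₀ : Fin n → ℝ) ⬝ᵥ (g ∘ Sum.inl) := inner_eq_dotProduct v₀ x
  have hmean : processMean k β v₀ p ≤ β * |t| ^ k := by
    rw [processMean]
    refine (le_abs_self _).trans ?_
    rw [abs_mul, p.abs_sign, abs_mul, abs_of_nonneg hβ, abs_pow, one_mul]
  have hxi : p.sign * √((k : ℝ) / n) * ξ ≤ √((k : ℝ) / n) * (1 + ξ ^ 2) := by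
    have h1 : p.sign * ξ ≤ 1 + ξ ^ 2 := by
      refine (le_abs_self _).trans ?_
      rw [abs_mul, p.abs_sign, one_mul]
      nlinarith [sq_abs ξ, sq_nonneg (|ξ| - 1), abs_nonneg ξ]
    calc _ = √((k : ℝ) / n) * (p.sign * ξ) := by ring
      _ ≤ _ := mul_le_mul_of_nonneg_left h1 (Real.sqrt_nonneg _)
  have hinner := inner_le_abs_inner_add hv₀ p.norm_vec x
  rw [← ht] at hinner
  have hv0abs : |inner ℝ v₀ x| ≤ 1 + inner ℝ v₀ x ^ 2 := by
    nlinarith [sq_abs (inner ℝ v₀ x), sq_nonneg (|inner ℝ v₀ x| - 1), abs_nonneg (inner ℝ v₀ x)]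
  -- A quadratic majorant whose weight `√n` balances the typical size `1/√n` of `S / n`; thus only
  -- second moments are needed.
  have hS1 : |S / n| ≤ √n * (S / n) ^ 2 + (√n)⁻¹ := by
    have h1 : 0 ≤ (√(n : ℝ))⁻¹ * (√n * |S / n| - 1) ^ 2 := by positivity
    have h2 : (√(n : ℝ))⁻¹ * (√n * |S / n| - 1) ^ 2 =
        √n * (S / n) ^ 2 - 2 * |S / n| + (√n)⁻¹ := by
      rw [← sq_abs (S / n)]
      field_simp
      ring
    linarith [abs_nonneg (S / n)]
  have hxn : ‖x‖ / √n ≤ 1 + |S / n| := by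
    have h1 : (‖x‖ / √n) ^ 2 = 1 + S / n := by
      rw [div_pow, hnorm, pow_two, hr2]
      field_simp
      ring
    have h2 : 0 ≤ ‖x‖ / √n := by positivity
    nlinarith [le_abs_self (S / n), abs_nonneg (S / n)]
  have hsq1 : √(1 - t ^ 2) ≤ 1 := Real.sqrt_le_one.2 (by nlinarith [sq_nonneg t])
  have hsq0 : 0 ≤ √(1 - t ^ 2) := Real.sqrt_nonneg _
  have hMt := hM |t| ⟨abs_nonneg t, habs⟩
  rw [sq_abs] at hMt
  have hk0 : (0 : ℝ) ≤ k := by positivity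
  have hmain : k / √n * inner ℝ p.vec x ≤ k / √n * (1 + inner ℝ v₀ x ^ 2) +
      k * √(1 - t ^ 2) + k * (√n * (S / n) ^ 2 + (√n)⁻¹) := by
    calc k / √n * inner ℝ p.vec x
        ≤ k / √n * (|inner ℝ v₀ x| + √(1 - t ^ 2) * ‖x‖) :=
          mul_le_mul_of_nonneg_left hinner (by positivity)
      _ = k / √n * |inner ℝ v₀ x| + k * √(1 - t ^ 2) * (‖x‖ / √n) := by ring
      _ ≤ k / √n * (1 + inner ℝ v₀ x ^ 2) + k * √(1 - t ^ 2) * (1 + |S / n|) := by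
          gcongr
      _ = k / √n * (1 + inner ℝ v₀ x ^ 2) + k * √(1 - t ^ 2) +
            k * (√(1 - t ^ 2) * |S / n|) := by ring
      _ ≤ _ := by
          gcongr
          exact (mul_le_of_le_one_left (abs_nonneg _) hsq1).trans hS1
  rw [hdot, comparisonBound, ← hv0x]
  linarith

theorem integrable_and_integral_comparisonBound (hn : 1 ≤ n) (M : ℝ)
    {v₀ : EuclideanSpace ℝ (Fin n)} (hv₀ : ‖v₀‖ = 1) :
    Integrable (comparisonBound k M v₀) (stdGauss (Fin n ⊕ Unit)) ∧
      ∫ g, comparisonBound k M v₀ g ∂(stdGauss (Fin n ⊕ Unit)) =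
        M + (k * (sqVariance + 1) + 2 * k + 2 * √k) / √n := by
  have hn0 : (0 : ℝ) < n := by exact_mod_cast hn
  have hr : 0 < √(n : ℝ) := Real.sqrt_pos.2 hn0
  have hr2 : √(n : ℝ) * √n = n := Real.mul_self_sqrt hn0.le
  set A : (Fin n → ℝ) → ℝ := fun g => (∑ l, (g l ^ 2 - 1)) ^ 2 with hA
  set B : (Fin n → ℝ) → ℝ := fun g => ((v₀ : Fin n → ℝ) ⬝ᵥ g) ^ 2 with hB
  set D : (Unit → ℝ) → ℝ := fun g => ((fun _ => 1) ⬝ᵥ g) ^ 2 with hD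
  have iA : Integrable (fun g : Fin n ⊕ Unit → ℝ => A (g ∘ Sum.inl))
      (stdGauss (Fin n ⊕ Unit)) := by
    have h : ExpGrowth fun g : Fin n ⊕ Unit → ℝ =>
        ∑ l, (g (Sum.inl l) * g (Sum.inl l) + (-1)) :=
      ExpGrowth.sum _ fun l _ =>
        ((ExpGrowth.eval _).mul (ExpGrowth.eval _)).add (ExpGrowth.const (-1))
    refine ((h.mul h).mono fun g => le_of_eq ?_).integrable_of_continuous (by fun_prop)
    simp only [hA, Function.comp, pow_two, sub_eq_add_neg]
  have iB : Integrable (fun g : Fin n ⊕ Unit → ℝ => B (g ∘ Sum.inl))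
      (stdGauss (Fin n ⊕ Unit)) := by
    have h : ExpGrowth fun g : Fin n ⊕ Unit → ℝ => ∑ l, v₀ l * g (Sum.inl l) :=
      ExpGrowth.sum _ fun l _ => (ExpGrowth.const _).mul (ExpGrowth.eval _)
    refine ((h.mul h).mono fun g => le_of_eq ?_).integrable_of_continuous
      (by simp only [hB, dotProduct]; fun_prop)
    simp only [hB, Function.comp, pow_two, dotProduct]
  have iD : Integrable (fun g : Fin n ⊕ Unit → ℝ => D (g ∘ Sum.inr))
      (stdGauss (Fin n ⊕ Unit)) := by
    have h : ExpGrowth fun g : Fin n ⊕ Unit → ℝ => ∑ l, 1 * g (Sum.inr l) :=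
      ExpGrowth.sum _ fun l _ => (ExpGrowth.const _).mul (ExpGrowth.eval _)
    refine ((h.mul h).mono fun g => le_of_eq ?_).integrable_of_continuous
      (by simp only [hD, dotProduct]; fun_prop)
    simp only [hD, Function.comp, pow_two, dotProduct]
  have eA : ∫ g : Fin n ⊕ Unit → ℝ, A (g ∘ Sum.inl) ∂(stdGauss (Fin n ⊕ Unit)) =
      n * sqVariance := by
    rw [integral_comp_inl A, hA, integral_sq_sum_sq_sub_one, Fintype.card_fin]
  have eB : ∫ g : Fin n ⊕ Unit → ℝ, B (g ∘ Sum.inl) ∂(stdGauss (Fin n ⊕ Unit)) = 1 := by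
    rw [integral_comp_inl B, hB, integral_sq_dotProduct_stdGauss, ← inner_eq_dotProduct,
      real_inner_self_eq_norm_sq, hv₀, one_pow]
  have eD : ∫ g : Fin n ⊕ Unit → ℝ, D (g ∘ Sum.inr) ∂(stdGauss (Fin n ⊕ Unit)) = 1 := by
    rw [integral_comp_inr D, hD, integral_sq_dotProduct_stdGauss]
    simp [dotProduct]
  have hfun : comparisonBound k M v₀ = fun g =>
      (M + k * (√n)⁻¹ + k / √n + √((k : ℝ) / n)) + (k * √n / (n : ℝ) ^ 2) * A (g ∘ Sum.inl) +
        k / √n * B (g ∘ Sum.inl) + √((k : ℝ) / n) * D (g ∘ Sum.inr) := by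
    ext g
    simp only [comparisonBound, hA, hB, hD]
    ring
  have i1 := (integrable_const (μ := stdGauss (Fin n ⊕ Unit))
    (M + k * (√n)⁻¹ + k / √n + √((k : ℝ) / n))).add (iA.const_mul (k * √n / (n : ℝ) ^ 2))
  have i2 := i1.add (iB.const_mul (k / √n))
  have i3 := iD.const_mul √((k : ℝ) / n)
  rw [hfun]
  refine ⟨i2.add i3, ?_⟩
  have e3 := integral_add i2 i3
  have e2 := integral_add i1 (iB.const_mul (k / √n))
  have e1 := integral_add (integrable_const (μ := stdGauss (Fin n ⊕ Unit))
    (M + k * (√n)⁻¹ + k / √n + √((k : ℝ) / n))) (iA.const_mul (k * √n / (n : ℝ) ^ 2))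
  simp only [Pi.add_apply] at e1 e2 e3
  rw [e3, e2, e1, integral_const_mul, integral_const_mul, integral_const_mul, eA, eB, eD,
    Real.sqrt_div (by positivity)]
  have e4 : (k : ℝ) * √n / (n : ℝ) ^ 2 * (n * sqVariance) = k * sqVariance / √n := by
    have h5 : (n : ℝ) ^ 2 = n * (√n * √n) := by rw [hr2, pow_two]
    rw [h5]
    field_simp
  rw [e4]
  simp only [integral_const, probReal_univ, one_smul]
  field_simp
  ring

theorem integral_opNorm_spiked_le (hk : 1 ≤ k) (hn : 1 ≤ n) {β M : ℝ} (hβ : 0 ≤ β)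
    (hM : ∀ t ∈ Set.Icc (0 : ℝ) 1, β * t ^ k + k * √(1 - t ^ 2) ≤ M)
    {v₀ : EuclideanSpace ℝ (Fin n)} (hv₀ : ‖v₀‖ = 1) :
    ∫ G, opNorm (spiked β v₀ G) ∂(stdGauss (Fin k → Fin n)) ≤
      M + (k * (sqVariance + 1) + 2 * k + 2 * √k) / √n := by
  have := SignedSphere.nonempty hn
  obtain ⟨hi, he⟩ := integrable_and_integral_comparisonBound (k := k) hn M hv₀
  rw [← he]
  exact integral_sup_affine_le
    (isLUB_opNorm_spiked hk hn β v₀ (TopologicalSpace.denseRange_denseSeq (SignedSphere n)))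
    (fun i j => abs_processCoeff_dotProduct_le _ _)
    (fun i j => processCoeff_sub_le_comparisonCoeff_sub _ _) hi
    fun i g => comparison_le_comparisonBound hn hβ hM hv₀ _ g

theorem exists_isGreatest_spiked (hk : 1 ≤ k) {β : ℝ} (hβ : 0 ≤ β) :
    ∃ M : ℝ, IsGreatest
        ((fun τ : ℝ => β * (τ / √(1 + τ ^ 2)) ^ k + k / √(1 + τ ^ 2)) '' Set.Ici 0) M ∧
      ∀ t ∈ Set.Icc (0 : ℝ) 1, β * t ^ k + k * √(1 - t ^ 2) ≤ M := by
  set f : ℝ → ℝ := fun t => β * t ^ k + k * √(1 - t ^ 2) with hf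
  have hfc : Continuous f := by fun_prop
  have hk0 : (0 : ℝ) ≤ k := by positivity
  -- The endpoint `t = 1` corresponds to `τ = ∞` and must be avoided. At `t = β² / (1 + β²)`,
  -- Bernoulli's inequality loses at most `β k / (1 + β²)` in the first term, and the square root
  -- term regains at least as much.
  obtain ⟨t₁, ⟨ht₁0, ht₁1⟩, ht₁⟩ : ∃ t ∈ Set.Ico (0 : ℝ) 1, f 1 ≤ f t := by
    have hb : 0 < 1 + β ^ 2 := by positivity
    refine ⟨β ^ 2 / (1 + β ^ 2), ⟨by positivity, by rw [div_lt_one hb]; linarith⟩, ?_⟩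
    have h1 : 1 + k * (β ^ 2 / (1 + β ^ 2) - 1) ≤ (β ^ 2 / (1 + β ^ 2)) ^ k := by
      have h0 : 0 ≤ β ^ 2 / (1 + β ^ 2) := by positivity
      have h := one_add_mul_le_pow (a := β ^ 2 / (1 + β ^ 2) - 1) (by linarith) k
      rwa [add_sub_cancel] at h
    have h2 : β / (1 + β ^ 2) ≤ √(1 - (β ^ 2 / (1 + β ^ 2)) ^ 2) := by
      refine Real.le_sqrt_of_sq_le ?_
      have h3 : 1 - (β ^ 2 / (1 + β ^ 2)) ^ 2 - (β / (1 + β ^ 2)) ^ 2 = 1 / (1 + β ^ 2) := by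
        field_simp
        ring
      have h4 : 0 ≤ 1 / (1 + β ^ 2) := by positivity
      linarith
    have h5 : β ^ 2 / (1 + β ^ 2) - 1 = -(1 / (1 + β ^ 2)) := by
      field_simp
      ring
    have h6 := mul_le_mul_of_nonneg_left h1 hβ
    have h7 := mul_le_mul_of_nonneg_left h2 hk0
    have h8 : β * (1 + k * (β ^ 2 / (1 + β ^ 2) - 1)) + k * (β / (1 + β ^ 2)) = β := by
      rw [h5]; ring
    simp only [hf, one_pow, sub_self, Real.sqrt_zero, mul_zero, add_zero, mul_one]
    linarith
  obtain ⟨t₂, ht₂, hmax⟩ := isCompact_Icc.exists_isMaxOn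
    (Set.nonempty_Icc.2 (zero_le_one (α := ℝ))) hfc.continuousOn
  have hmax' : ∀ t ∈ Set.Icc (0 : ℝ) 1, f t ≤ f t₂ := fun t ht => hmax ht
  obtain ⟨t, ⟨ht0, ht1⟩, htmax⟩ : ∃ t ∈ Set.Ico (0 : ℝ) 1, ∀ s ∈ Set.Icc (0 : ℝ) 1, f s ≤ f t := by
    rcases ht₂.2.lt_or_eq with h | h
    · exact ⟨t₂, ⟨ht₂.1, h⟩, hmax'⟩
    · subst h
      exact ⟨t₁, ⟨ht₁0, ht₁1⟩, fun s hs => (hmax' s hs).trans ht₁⟩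
  have hval : ∀ τ : ℝ, 0 ≤ τ → τ / √(1 + τ ^ 2) ∈ Set.Icc (0 : ℝ) 1 ∧
      β * (τ / √(1 + τ ^ 2)) ^ k + k / √(1 + τ ^ 2) = f (τ / √(1 + τ ^ 2)) := by
    intro τ hτ
    have hp : 0 < 1 + τ ^ 2 := by positivity
    have hs : 0 < √(1 + τ ^ 2) := Real.sqrt_pos.2 hp
    refine ⟨⟨by positivity, ?_⟩, ?_⟩
    · rw [div_le_one hs]
      exact Real.le_sqrt_of_sq_le (by linarith)
    · have h1 : √(1 - (τ / √(1 + τ ^ 2)) ^ 2) = 1 / √(1 + τ ^ 2) := by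
        rw [div_pow, Real.sq_sqrt hp.le, one_div, ← Real.sqrt_inv]
        congr 1
        field_simp
        simp
      simp only [hf, h1]
      ring
  refine ⟨f t, ⟨⟨t / √(1 - t ^ 2), ?_, ?_⟩, ?_⟩, htmax⟩
  · exact div_nonneg ht0 (Real.sqrt_nonneg _)
  · have hp : 0 < 1 - t ^ 2 := by nlinarith
    have hτ : 0 ≤ t / √(1 - t ^ 2) := div_nonneg ht0 (Real.sqrt_nonneg _)
    have h1 : √(1 + (t / √(1 - t ^ 2)) ^ 2) = 1 / √(1 - t ^ 2) := by
      rw [div_pow, Real.sq_sqrt hp.le, one_div, ← Real.sqrt_inv]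
      congr 1
      have := hp.ne'
      field_simp
      ring
    have h2 : t / √(1 - t ^ 2) / √(1 + (t / √(1 - t ^ 2)) ^ 2) = t := by
      have := (Real.sqrt_pos.2 hp).ne'
      rw [h1]
      field_simp
    change β * _ ^ k + k / _ = _
    rw [(hval _ hτ).2, h2]
  · rintro _ ⟨τ, hτ, rfl⟩
    change β * _ ^ k + k / _ ≤ _
    rw [(hval τ hτ).2]
    exact htmax _ (hval τ hτ).1

end Expectation

theorem IsStdGaussianTensor.hasLaw {k n : ℕ} {Ω : Type*} [MeasurableSpace Ω]
    {G : Ω → Tensor k n} {P : Measure Ω} [IsProbabilityMeasure P] (hG : IsStdGaussianTensor G P) :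
    HasLaw G (stdGauss (Fin k → Fin n)) P where
  aemeasurable := aemeasurable_pi_lambda _ fun i => (hG.1 i).aemeasurable
  map_eq := by
    have h := (iIndepFun_iff_map_fun_eq_pi_map fun i => (hG.1 i).aemeasurable).1 hG.2
    simp only [(hG.1 _).map_eq] at h
    exact h

end SpikedTensor

/-! ### Transfer to the given probability spaces and conclusion. -/

theorem mainTheorem9 (k : ℕ) (hk : 1 ≤ k) (β : ℝ) (hβ : 0 ≤ β)
    (v₀ : ∀ n : ℕ, EuclideanSpace ℝ (Fin n)) (hv₀ : ∀ n, 1 ≤ n → ‖v₀ n‖ = 1)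
    {Ω : ℕ → Type*} [∀ n, MeasurableSpace (Ω n)]
    (P : ∀ n, Measure (Ω n)) [∀ n, IsProbabilityMeasure (P n)]
    (G : ∀ n, Ω n → SpikedTensor.Tensor k n)
    (hG : ∀ n, 1 ≤ n → SpikedTensor.IsStdGaussianTensor (G n) (P n)) :
    (∀ n, 1 ≤ n →
      Integrable (fun ω => SpikedTensor.opNorm (SpikedTensor.spiked β (v₀ n) (G n ω))) (P n)) ∧
    (∃ M : ℝ,
      IsGreatest ((fun τ : ℝ => β * (τ / √(1 + τ ^ 2)) ^ k + k / √(1 + τ ^ 2)) '' Set.Ici 0) M ∧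
      Filter.limsup
        (fun n : ℕ =>
          ((∫ ω, SpikedTensor.opNorm (SpikedTensor.spiked β (v₀ n) (G n ω)) ∂(P n) : ℝ) : EReal))
        Filter.atTop ≤ (M : EReal)) ∧
    (∀ n : ℕ, 1 ≤ n → ∀ s : ℝ, 0 ≤ s →
      (P n).real {ω | s ≤ |SpikedTensor.opNorm (SpikedTensor.spiked β (v₀ n) (G n ω)) -
          ∫ ω', SpikedTensor.opNorm (SpikedTensor.spiked β (v₀ n) (G n ω')) ∂(P n)|} ≤
        2 * Real.exp (-(n * s ^ 2 / (2 * k)))) := by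
  have hlub := fun n (hn : 1 ≤ n) =>
    have := SpikedTensor.SignedSphere.nonempty hn
    SpikedTensor.isLUB_opNorm_spiked hk hn β (v₀ n)
      (TopologicalSpace.denseRange_denseSeq (SpikedTensor.SignedSphere n))
  have hvar := fun n (hn : 1 ≤ n) (i j : ℕ) =>
    have := SpikedTensor.SignedSphere.nonempty hn
    SpikedTensor.abs_processCoeff_dotProduct_le (k := k)
      (TopologicalSpace.denseSeq (SpikedTensor.SignedSphere n) i)
      (TopologicalSpace.denseSeq (SpikedTensor.SignedSphere n) j)
  have hlaw := fun n hn => (hG n hn).hasLaw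
  have hmeas := fun n hn => SpikedTensor.measurable_sup_affine (hlub n hn)
  have hint := fun n hn => (hlaw n hn).integral_comp (hmeas n hn).aestronglyMeasurable
  simp only [Function.comp_def] at hint
  obtain ⟨M, hM, hMt⟩ := SpikedTensor.exists_isGreatest_spiked hk hβ
  refine ⟨fun n hn => ?_, ⟨M, hM, ?_⟩, fun n hn s hs => ?_⟩
  · have h := SpikedTensor.integrable_sup_affine (hlub n hn) (hvar n hn)
    rw [← (hlaw n hn).map_eq] at h
    exact h.comp_aemeasurable (hlaw n hn).aemeasurable
  -- For `n ≥ 1` the mean is at most `M + C / √n`, with `C` independent of `n`.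
  · set C : ℝ := k * (SpikedTensor.sqVariance + 1) + 2 * k + 2 * √k
    have hlim : Filter.Tendsto (fun n : ℕ => ((M + C / √n : ℝ) : EReal)) Filter.atTop
        (nhds (M : EReal)) := by
      refine (continuous_coe_real_ereal.tendsto M).comp ?_
      have h := (Real.tendsto_sqrt_atTop.comp tendsto_natCast_atTop_atTop).const_div_atTop C
      simpa using h.const_add M
    rw [← hlim.limsup_eq]
    refine Filter.limsup_le_limsup ?_
    filter_upwards [Filter.eventually_ge_atTop 1] with n hn
    rw [EReal.coe_le_coe_iff, hint n hn]
    exact SpikedTensor.integral_opNorm_spiked_le hk hn hβ hMt (hv₀ n hn)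
  · have h := SpikedTensor.measureReal_abs_sub_integral_sup_affine_le (hlub n hn) (hvar n hn) hs
    have hset : MeasurableSet {g : SpikedTensor.Tensor k n |
        s ≤ |SpikedTensor.opNorm (SpikedTensor.spiked β (v₀ n) g) -
          ∫ g', SpikedTensor.opNorm (SpikedTensor.spiked β (v₀ n) g')
            ∂(SpikedTensor.stdGauss (Fin k → Fin n))|} :=
      measurableSet_le measurable_const ((hmeas n hn).sub_const _).abs
    rw [hint n hn]
    have hm := (hlaw n hn).measure_eq hset
    rw [Measure.real, hm]
    refine h.trans_eq ?_
    have hn0 : (n : ℝ) ≠ 0 := by exact_mod_cast (by omega : n ≠ 0)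
    have hk0 : (k : ℝ) ≠ 0 := by exact_mod_cast (by omega : k ≠ 0)
    congr 3
    field_simp
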